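/- Let $(\Omega,\rho_\Omega)$ be a complete separable metric space with its Borel $\sigma$-algebra, $\mu$ a Borel probability measure on $\Omega$, $t_0<T$ and $u_{\min}<u_{\max}$ real numbers, $f_0,f_1:\mathbb R^n\times\Omega\to\mathbb R^n$, $g:\mathbb R^n\times\Omega\to\mathbb R$ and $\varphi:\Omega\to\mathbb R^n$. Write $f(x,u,\omega)=f_0(x,\omega)+u f_1(x,\omega)$ and $U=[u_{\min},u_{\max}]$. An admissible process $(u,\{x(\cdot,\omega)\}_{\omega\in\Omega})$ consists of a measurable $u:[t_0,T]\to\mathbb R$ with $u(t)\in U$ a.e. and arcs $x(\cdot,\omega)\in W^{1,1}([t_0,T];\mathbb R^n)$ with $x(t,\omega)=\varphi(\omega)+\int_{t_0}^t f(x(s,\omega),u(s),\omega)\,ds$ for all $t\in[t_0,T]$, $\omega\in\Omega$. Problem $(P)$ is to minimize $\int_\Omega g(x(T,\omega),\omega)\,d\mu(\omega)$ over admissible processes. (H0): $f_i(x,\cdot)$ is measurable for every $x$, and there are constants $c_i,k_i>0$ with $|f_i(x,\omega)|\le c_i(1+|x|)$ and $|f_i(x,\omega)-f_i(x',\omega)|\le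 k_i|x-x'|$ for all $x,x',\omega$ ($i=0,1$); $g$ is Borel measurable, bounded, and Lipschitz in $x$ uniformly in $\omega$. (H1), for a process $(\bar u,\bar x)$ and some $\delta>0$, with $B_t(\omega)$ the open ball of radius $\delta$ about $\bar x(t,\omega)$: (i) there is a nondecreasing $\theta:[0,\infty)\to[0,\infty)$ with $\theta(s)\to0$ as $s\to0^+$ and $\int_{t_0}^T\sup_{x\in B_t(\omega),\,u\in U}|f(x,u,\omega_1)-f(x,u,\omega_2)|\,dt\le\theta(\rho_\Omega(\omega_1,\omega_2))$ for all $\omega,\omega_1,\omega_2\in\Omega$; (ii) $g(\cdot,\omega)$ is continuously differentiable on $B_T(\omega)$ for every $\omega$; for every $x$, $\omega\mapsto\nabla_xg(x,\omega)$ is continuous on $\{\omega: x\in B_T(\omega)\}$; and $\nabla_xg(\bar x(T,\omega),\omega)$ is bounded in $\omega$; (iii) for all $\omega\in\Omega$, $u\in U$ and a.e. $t$, $f(\cdot,u,\omega)$ is continuously differentiable on $B_t(\omega)$; and for every $\omega_0$ and $\eta>0$ there is $r>0$ with $|\nabla_xf(x,u,\omega)-\nabla_xf(x,u,\omega_0)|\le\eta$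 whenever $\rho_\Omega(\omega,\omega_0)<r$, $t\in[t_0,T]$, $x\in B_t(\omega)\cap B_t(\omega_0)$, $u\in U$; (iv) for all $\omega\in\Omega$ and a.e. $t$, $f_0(\cdot,\omega)$ and $f_1(\cdot,\omega)$ are twice continuously differentiable on $B_t(\omega)$; and their first and second derivatives in $x$ at $(\bar x(t,\omega),\omega)$ are bounded by constants for all $\omega\in\operatorname{supp}\mu$ and a.e. $t$. Assume (H0) and (H1), and let $(\bar u,\bar x)$ and $p$ be as in one of the following two cases. (A) Known initial condition: $\varphi\equiv x_0$; $(\bar u,\bar x)$ is a $W^{1,1}$-local minimizer, i.e. for some $\epsilon>0$ its cost is at most that of every admissible process $(u,x)$ with $\|\bar x(\cdot,\omega)-x(\cdot,\omega)\|_{W^{1,1}([t_0,T];\mathbb R^n)}\le\epsilon$ for all $\omega\in\operatorname{supp}\mu$; and $p:[t_0,T]\times\Omega\to\mathbb R^n$ is the adjoint arc of the Pontryagin maximum principle: $p$ is measurable and, for every $\omega\in\operatorname{supp}\mu$, $p(\cdot,\omega)\in W^{1,1}$, $-\dot p(t,\omega)=[\nabla_xf(\bar x(t,\omega),\bar u(t),\omega)]^\top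 p(t,\omega)$ for a.e. $t$, and $-p(T,\omega)=\nabla_xg(\bar x(T,\omega),\omega)$. (B) Uncertain initial condition: $\varphi\in L^2(\mu,\Omega;\mathbb R^n)$; $(\bar u,\bar x)$ is a $W^{1,1}$-local minimizer for the $L^2$-valued state, i.e. for some $\epsilon>0$ its cost is at most that of every admissible process $(u,x)$ with $\|\bar x-x\|_{W^{1,1}([t_0,T];L^2(\mu,\Omega;\mathbb R^n))}\le\epsilon$ (for instance a global minimizer); and $p\in W^{1,1}([t_0,T];L^2(\mu,\Omega;\mathbb R^n))$ is the adjoint arc, the solution in $L^2$ of $-\dot p(t)=\big(\tfrac{\partial f}{\partial x}(\bar x(t),\bar u(t))\big)^*p(t)$ for a.e. $t$, $-p(T)=\nabla_xg(\bar x(T,\cdot),\cdot)$. Let $\Psi(t)=\int_\Omega p(t,\omega)\cdot f_1(\bar x(t,\omega),\omega)\,d\mu(\omega)$ for $t\in[t_0,T]$ (the integrand is integrable). Then, for a.e. $t\in[t_0,T]$, $\bar u(t)=u_{\max}$ if $\Psi(t)>0$ and $\bar u(t)=u_{\min}$ if $\Psi(t)<0$. Moreover, on every open interval $(a,b)\subset[t_0,T]$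 on which $\Psi=0$, for a.e. $t\in(a,b)$, $$\int_\Omega p\cdot[f_0,[f_0,f_1]]\,d\mu(\omega)+\bar u(t)\int_\Omega p\cdot[f_1,[f_0,f_1]]\,d\mu(\omega)=0,$$ where both integrands are integrable, $p$ is taken at $(t,\omega)$ and the brackets at $(\bar x(t,\omega),\omega)$, and $[v,w]=w'v-v'w$ is the Lie bracket in $x$. -/

import Mathlib

open MeasureTheory Filter Topology Set
open scoped ENNReal

/-- The state space `ℝⁿ` with its Euclidean norm. -/
abbrev StateSpace (n : ℕ) : Type := EuclideanSpace ℝ (Fin n)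

/-- The data of the averaged control-affine problem `(P)` with a scalar control:
minimize `∫ g (x(T,ω), ω) dμ(ω)` subject to `ẋ = f₀(x,ω) + u(t) f₁(x,ω)` on `[t₀, T]`,
`x(t₀,ω) = φ(ω)` and `u(t) ∈ [umin, umax]`. -/
structure AffineProblem (n : ℕ) (Ω : Type*) where
  t₀ : ℝ
  T : ℝ
  umin : ℝ
  umax : ℝ
  f₀ : StateSpace n → Ω → StateSpace n
  f₁ : StateSpace n → Ω → StateSpace n
  g : StateSpace n → Ω → ℝ
  φ : Ω → StateSpace n
  time_lt : t₀ < T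
  control_lt : umin < umax

/-- `z` belongs to `W^{1,1}([a,b]; X)` (continuous representative) and `v` is a version of its
derivative. -/
def HasW11Deriv {X : Type*} [NormedAddCommGroup X] [NormedSpace ℝ X]
    (a b : ℝ) (z v : ℝ → X) : Prop :=
  IntervalIntegrable v volume a b ∧ ∀ t ∈ Icc a b, z t = z a + ∫ s in a..t, v s

/-- The norm `‖z‖₁ + ‖ż‖₁` of `W^{1,1}([a,b]; X)`, with values in `[0,∞]`. -/
noncomputable def w11Norm {X : Type*} [NormedAddCommGroup X] [NormedSpace ℝ X]
    (a b : ℝ) (z : ℝ → X) : ℝ≥0∞ :=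
  (∫⁻ t in Icc a b, ‖z t‖ₑ) + ∫⁻ t in Icc a b, ‖deriv z t‖ₑ

/-- The norm of `W^{1,1}([a,b]; L²(μ; ℝⁿ))`, with values in `[0,∞]`, of the curve represented by
the family of arcs `t ↦ z t ω`. -/
noncomputable def w11L2Norm {n : ℕ} {Ω : Type*} [MeasurableSpace Ω] (μ : Measure Ω)
    (a b : ℝ) (z : ℝ → Ω → StateSpace n) : ℝ≥0∞ :=
  (∫⁻ t in Icc a b, eLpNorm (z t) 2 μ) +
    ∫⁻ t in Icc a b, eLpNorm (fun ω => deriv (fun s => z s ω) t) 2 μ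

namespace AffineProblem

variable {n : ℕ} {Ω : Type*}

/-- The dynamics `f(x,u,ω) = f₀(x,ω) + u f₁(x,ω)`. -/
def dyn (P : AffineProblem n Ω) (x : StateSpace n) (u : ℝ) (ω : Ω) : StateSpace n :=
  P.f₀ x ω + u • P.f₁ x ω

/-- The Jacobian `∂f/∂x (x,u,ω)`. -/
noncomputable def dynJac (P : AffineProblem n Ω) (x : StateSpace n) (u : ℝ) (ω : Ω) :
    StateSpace n →L[ℝ] StateSpace n :=
  fderiv ℝ (fun y => P.dyn y u ω) x

/-- Admissible controls: measurable, with values in `[umin, umax]` almost everywhere. -/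
def IsAdmissibleControl (P : AffineProblem n Ω) (u : ℝ → ℝ) : Prop :=
  AEStronglyMeasurable u (volume.restrict (Icc P.t₀ P.T)) ∧
    ∀ᵐ t ∂volume.restrict (Icc P.t₀ P.T), u t ∈ Icc P.umin P.umax

/-- Admissible processes: an admissible control with the family of arcs `x(·,ω) ∈ W^{1,1}` that
solve `x(t,ω) = φ(ω) + ∫_{t₀}^t f(x(s,ω),u(s),ω) ds`, for each `ω`. -/
def IsAdmissible (P : AffineProblem n Ω) (u : ℝ → ℝ) (x : ℝ → Ω → StateSpace n) : Prop :=
  P.IsAdmissibleControl u ∧ ∀ ω, x P.t₀ ω = P.φ ω ∧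
    HasW11Deriv P.t₀ P.T (fun t => x t ω) (fun t => P.dyn (x t ω) (u t) ω)

variable [MetricSpace Ω] [MeasurableSpace Ω]

/-- The averaged cost. -/
noncomputable def cost (P : AffineProblem n Ω) (μ : Measure Ω) (x : ℝ → Ω → StateSpace n) : ℝ :=
  ∫ ω, P.g (x P.T ω) ω ∂μ

/-- `W^{1,1}`-local minimizer: optimal among all admissible processes whose arcs are
`ε`-close in `W^{1,1}([t₀,T]; ℝⁿ)` for every `ω` in the support of `μ`. -/
def IsW11LocalMin (P : AffineProblem n Ω) (μ : Measure Ω) (u : ℝ → ℝ)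
    (x : ℝ → Ω → StateSpace n) : Prop :=
  P.IsAdmissible u x ∧ ∃ ε : ℝ, 0 < ε ∧ ∀ (v : ℝ → ℝ) (y : ℝ → Ω → StateSpace n),
    P.IsAdmissible v y →
    (∀ ω ∈ μ.support, w11Norm P.t₀ P.T (fun t => x t ω - y t ω) ≤ ENNReal.ofReal ε) →
    P.cost μ x ≤ P.cost μ y

/-- `W^{1,1}`-local minimizer when the state is regarded as a curve in `L²(μ; ℝⁿ)`: optimal among
all admissible processes that are `ε`-close in `W^{1,1}([t₀,T]; L²(μ; ℝⁿ))`. Every (global)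
minimizer is one. -/
def IsW11LocalMinL2 (P : AffineProblem n Ω) (μ : Measure Ω) (u : ℝ → ℝ)
    (x : ℝ → Ω → StateSpace n) : Prop :=
  P.IsAdmissible u x ∧ ∃ ε : ℝ, 0 < ε ∧ ∀ (v : ℝ → ℝ) (y : ℝ → Ω → StateSpace n),
    P.IsAdmissible v y →
    w11L2Norm μ P.t₀ P.T (fun t ω => x t ω - y t ω) ≤ ENNReal.ofReal ε →
    P.cost μ x ≤ P.cost μ y

/-- Assumptions (H0) on the data. -/
structure H0 (P : AffineProblem n Ω) : Prop where
  meas_f₀ : ∀ x, Measurable (P.f₀ x)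
  meas_f₁ : ∀ x, Measurable (P.f₁ x)
  growth_f₀ : ∃ c : ℝ, 0 < c ∧ ∀ x ω, ‖P.f₀ x ω‖ ≤ c * (1 + ‖x‖)
  growth_f₁ : ∃ c : ℝ, 0 < c ∧ ∀ x ω, ‖P.f₁ x ω‖ ≤ c * (1 + ‖x‖)
  lip_f₀ : ∃ k : ℝ, 0 < k ∧ ∀ x y ω, ‖P.f₀ x ω - P.f₀ y ω‖ ≤ k * ‖x - y‖
  lip_f₁ : ∃ k : ℝ, 0 < k ∧ ∀ x y ω, ‖P.f₁ x ω - P.f₁ y ω‖ ≤ k * ‖x - y‖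
  meas_g : Measurable (fun z : StateSpace n × Ω => P.g z.1 z.2)
  bound_g : ∃ M : ℝ, 0 < M ∧ ∀ x ω, |P.g x ω| ≤ M
  lip_g : ∃ k : ℝ, 1 ≤ k ∧ ∀ x y ω, |P.g x ω - P.g y ω| ≤ k * ‖x - y‖

/-- Assumptions (H1), relative to a family of arcs `x` and a radius `δ > 0`. Continuity in `ω` of
a derivative at a fixed point is asked only where that point lies in the `δ`-tube on which
differentiability is assumed. -/
structure H1 (P : AffineProblem n Ω) (μ : Measure Ω) (x : ℝ → Ω → StateSpace n) (δ : ℝ) :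
    Prop where
  modulus : ∃ θ : ℝ → ℝ, (∀ s, 0 ≤ s → 0 ≤ θ s) ∧ MonotoneOn θ (Ici 0) ∧
    Tendsto θ (𝓝[>] 0) (𝓝 0) ∧
    ∀ ω ω₁ ω₂ : Ω,
      ∫⁻ t in Icc P.t₀ P.T, (⨆ y ∈ Metric.ball (x t ω) δ, ⨆ u ∈ Icc P.umin P.umax,
        ‖P.dyn y u ω₁ - P.dyn y u ω₂‖ₑ) ≤ ENNReal.ofReal (θ (dist ω₁ ω₂))
  diff_g : ∀ ω, DifferentiableOn ℝ (fun y => P.g y ω) (Metric.ball (x P.T ω) δ)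
  cont_grad_g : ∀ ω, ContinuousOn (gradient (fun y => P.g y ω)) (Metric.ball (x P.T ω) δ)
  cont_grad_g_param : ∀ y : StateSpace n,
    ContinuousOn (fun ω => gradient (fun z => P.g z ω) y) {ω | y ∈ Metric.ball (x P.T ω) δ}
  bound_grad_g : ∃ C : ℝ, 0 < C ∧ ∀ ω, ‖gradient (fun y => P.g y ω) (x P.T ω)‖ ≤ C
  c1_dyn : ∀ ω, ∀ u ∈ Icc P.umin P.umax, ∀ᵐ t ∂volume.restrict (Icc P.t₀ P.T),
    ContDiffOn ℝ 1 (fun y => P.dyn y u ω) (Metric.ball (x t ω) δ)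
  cont_jac_param : ∀ ω₀ : Ω, ∀ η : ℝ, 0 < η → ∃ r : ℝ, 0 < r ∧ ∀ ω, dist ω ω₀ < r →
    ∀ t ∈ Icc P.t₀ P.T, ∀ y ∈ Metric.ball (x t ω) δ ∩ Metric.ball (x t ω₀) δ,
      ∀ u ∈ Icc P.umin P.umax, ‖P.dynJac y u ω - P.dynJac y u ω₀‖ ≤ η
  c2_f₀ : ∀ ω, ∀ᵐ t ∂volume.restrict (Icc P.t₀ P.T),
    ContDiffOn ℝ 2 (fun y => P.f₀ y ω) (Metric.ball (x t ω) δ)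
  c2_f₁ : ∀ ω, ∀ᵐ t ∂volume.restrict (Icc P.t₀ P.T),
    ContDiffOn ℝ 2 (fun y => P.f₁ y ω) (Metric.ball (x t ω) δ)
  bound_f₀ : ∃ C₁ C₂ : ℝ, 0 < C₁ ∧ 0 < C₂ ∧ ∀ ω ∈ μ.support,
    ∀ᵐ t ∂volume.restrict (Icc P.t₀ P.T),
      ‖fderiv ℝ (fun y => P.f₀ y ω) (x t ω)‖ < C₁ ∧
      ‖fderiv ℝ (fderiv ℝ (fun y => P.f₀ y ω)) (x t ω)‖ < C₂
  bound_f₁ : ∃ C₁ C₂ : ℝ, 0 < C₁ ∧ 0 < C₂ ∧ ∀ ω ∈ μ.support,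
    ∀ᵐ t ∂volume.restrict (Icc P.t₀ P.T),
      ‖fderiv ℝ (fun y => P.f₁ y ω) (x t ω)‖ < C₁ ∧
      ‖fderiv ℝ (fderiv ℝ (fun y => P.f₁ y ω)) (x t ω)‖ < C₂

/-- The adjoint arc of the maximum principle for a known initial state: a jointly measurable `p`
with `p(·,ω) ∈ W^{1,1}`, `-ṗ = (∂f/∂x)ᵀ p` and `-p(T,ω) = ∇ₓ g(x(T,ω),ω)` for every `ω` in the
support of `μ`. The maximum condition is not part of the definition. -/
structure IsCostate (P : AffineProblem n Ω) (μ : Measure Ω) (u : ℝ → ℝ)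
    (x p : ℝ → Ω → StateSpace n) : Prop where
  meas : AEStronglyMeasurable (fun z : ℝ × Ω => p z.1 z.2)
    ((volume.restrict (Icc P.t₀ P.T)).prod μ)
  adjoint_eq : ∀ ω ∈ μ.support, HasW11Deriv P.t₀ P.T (fun t => p t ω)
    (fun t => -(ContinuousLinearMap.adjoint (P.dynJac (x t ω) (u t) ω)) (p t ω))
  terminal : ∀ ω ∈ μ.support, -p P.T ω = gradient (fun y => P.g y ω) (x P.T ω)

/-- The adjoint arc of the maximum principle for an uncertain initial state: the solution
`p ∈ W^{1,1}([t₀,T]; L²(μ; ℝⁿ))` of `-ṗ = (∂f/∂x)^* p`, `-p(T) = ∇ₓ g(x(T,·),·)`, the operator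
being the multiplication by the transposed Jacobian. The maximum condition is not part of the
definition. -/
structure IsCostateL2 (P : AffineProblem n Ω) (μ : Measure Ω) (u : ℝ → ℝ)
    (x : ℝ → Ω → StateSpace n) (p : ℝ → Lp (StateSpace n) 2 μ) : Prop where
  adjoint_eq : ∃ p' : ℝ → Lp (StateSpace n) 2 μ, HasW11Deriv P.t₀ P.T p p' ∧
    ∀ᵐ t ∂volume.restrict (Icc P.t₀ P.T), ∀ᵐ ω ∂μ,
      -(p' t) ω = (ContinuousLinearMap.adjoint (P.dynJac (x t ω) (u t) ω)) (p t ω)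
  terminal : ∀ᵐ ω ∂μ, -(p P.T) ω = gradient (fun y => P.g y ω) (x P.T ω)

/-- The switching function `Ψ(t) = ∫ p(t,ω) · f₁(x(t,ω),ω) dμ(ω)`. -/
noncomputable def switching (P : AffineProblem n Ω) (μ : Measure Ω)
    (x p : ℝ → Ω → StateSpace n) (t : ℝ) : ℝ :=
  ∫ ω, inner ℝ (p t ω) (P.f₁ (x t ω) ω) ∂μ

/-- The integrand `p · [f₀,[f₀,f₁]]` along `(x,p)`;
`VectorField.lieBracket` is `[V,W] = W'V - V'W`. -/
noncomputable def bracket₀ (P : AffineProblem n Ω) (x p : ℝ → Ω → StateSpace n) (t : ℝ)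
    (ω : Ω) : ℝ :=
  inner ℝ (p t ω) (VectorField.lieBracket ℝ (fun y => P.f₀ y ω)
    (VectorField.lieBracket ℝ (fun y => P.f₀ y ω) (fun y => P.f₁ y ω)) (x t ω))

/-- The integrand `p · [f₁,[f₀,f₁]]` along `(x,p)`. -/
noncomputable def bracket₁ (P : AffineProblem n Ω) (x p : ℝ → Ω → StateSpace n) (t : ℝ)
    (ω : Ω) : ℝ :=
  inner ℝ (p t ω) (VectorField.lieBracket ℝ (fun y => P.f₁ y ω)
    (VectorField.lieBracket ℝ (fun y => P.f₀ y ω) (fun y => P.f₁ y ω)) (x t ω))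

/-- The characterization of the control `u` along `(x,p)`: bang-bang where `Ψ ≠ 0`, and the
singular-arc equation on every open interval where `Ψ = 0`; all integrals exist. -/
structure ControlCharacterization (P : AffineProblem n Ω) (μ : Measure Ω) (u : ℝ → ℝ)
    (x p : ℝ → Ω → StateSpace n) : Prop where
  switching_integrable : ∀ t ∈ Icc P.t₀ P.T,
    Integrable (fun ω => inner ℝ (p t ω) (P.f₁ (x t ω) ω)) μ
  bang : ∀ᵐ t ∂volume.restrict (Icc P.t₀ P.T),
    (0 < P.switching μ x p t → u t = P.umax) ∧ (P.switching μ x p t < 0 → u t = P.umin)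
  singular : ∀ a b : ℝ, Ioo a b ⊆ Icc P.t₀ P.T →
    (∀ t ∈ Ioo a b, P.switching μ x p t = 0) →
    ∀ᵐ t ∂volume.restrict (Ioo a b),
      Integrable (P.bracket₀ x p t) μ ∧ Integrable (P.bracket₁ x p t) μ ∧
      (∫ ω, P.bracket₀ x p t ω ∂μ) + u t * (∫ ω, P.bracket₁ x p t ω ∂μ) = 0

end AffineProblem

/-!
Replace the control by a strict version `w`, Borel and `U`-valued everywhere, and solve the adjoint
equation `-q̇ = (∂f/∂x)ᵀ q` for every `ω`, so that `q` is measurable in `ω`.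

*Bang-bang.* Since `U` is convex, `w + ε (v - w)` is a strict control for every strict control `v`.
Its arcs are within `O(ε (1 + ‖φ(ω)‖))` of `x`, so both kinds of local minimality apply to it.
Along these arcs the derivative of `q · (y - x)` equals `ε (v - w) q · f₁` up to `o(ε)`, and
comparing the costs gives `∫ (v - w) Ψ dt ≤ 0`. The choice of `v` as an endpoint of `U` according
to the sign of `Ψ` yields the claim.

*Singular arcs.* Along the process, the derivative of `∫ q · h(x) dμ` is
`∫ q · [f₀, h] dμ + w ∫ q · [f₁, h] dμ`. The bracket `[f₁, f₁]` vanishes, so where `Ψ = 0` a first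
differentiation of `Ψ` gives `∫ q · [f₀, f₁] dμ = 0`, with no control in it, and a second one gives
the stated equation.

*Transfer.* Both adjoint equations are linear and determine the adjoint arc from its terminal value,
in `ℝⁿ` for each `ω` or in `L²`. Hence `p(t) = q(t)` almost everywhere for every `t`.
-/

/-! ### Arcs of class `W^{1,1}` -/

theorem le_mul_exp_of_le_add_integral {a b K c : ℝ} {f : ℝ → ℝ} (hK : 0 ≤ K)
    (hf : ContinuousOn f (Icc a b)) (h : ∀ t ∈ Icc a b, f t ≤ c + K * ∫ s in a..t, f s) :
    ∀ t ∈ Icc a b, f t ≤ c * Real.exp (K * (t - a)) := by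
  intro t ht
  have hab : a ≤ b := ht.1.trans ht.2
  have hcont : ContinuousOn (fun t => c + K * ∫ s in a..t, f s) (Icc a b) := by
    rw [← uIcc_of_le hab] at hf ⊢
    exact continuousOn_const.add (continuousOn_const.mul
      (intervalIntegral.continuousOn_primitive_interval hf.integrableOn_uIcc))
  have hderiv : ∀ s ∈ Ico a b,
      HasDerivWithinAt (fun t => c + K * ∫ r in a..t, f r) (K * f s) (Ici s) s := by
    intro s hs
    refine ((intervalIntegral.integral_hasDerivWithinAt_right (t := Ioi s) ?_ ?_ ?_).const_mul
      K).const_add c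
    · exact (hf.mono (Icc_subset_Icc_right hs.2.le)).intervalIntegrable_of_Icc hs.1
    · exact ⟨Ioc s b, Ioc_mem_nhdsGT hs.2, (hf.mono fun r hr =>
        ⟨hs.1.trans hr.1.le, hr.2⟩).aestronglyMeasurable measurableSet_Ioc⟩
    · exact (hf s (Ico_subset_Icc_self hs)).mono_of_mem_nhdsWithin
        (mem_of_superset (Ioc_mem_nhdsGT hs.2) fun r hr => ⟨hs.1.trans hr.1.le, hr.2⟩)
  have hbound := le_gronwallBound_of_liminf_deriv_right_le (δ := c) (K := K) (ε := 0) hcont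
    (fun s hs r hr => (hderiv s hs).liminf_right_slope_le hr) (by simp)
    (fun s hs => by
      rw [add_zero]
      exact mul_le_mul_of_nonneg_left (h s (Ico_subset_Icc_self hs)) hK) t ht
  rw [gronwallBound_ε0] at hbound
  exact (h t ht).trans hbound

section

variable {E : Type*} [NormedAddCommGroup E] {a b C : ℝ}

theorem intervalIntegrable_of_norm_le {f : ℝ → E} (hab : a ≤ b)
    (hf : AEStronglyMeasurable f (volume.restrict (Icc a b)))
    (hC : ∀ t ∈ Icc a b, ‖f t‖ ≤ C) : IntervalIntegrable f volume a b := by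
  rw [intervalIntegrable_iff_integrableOn_Ioc_of_le hab, ← integrableOn_Icc_iff_integrableOn_Ioc]
  exact Integrable.of_bound hf C ((ae_restrict_iff' measurableSet_Icc).2 (ae_of_all _ hC))

end

namespace HasW11Deriv

variable {X Y : Type*} [NormedAddCommGroup X] [NormedSpace ℝ X] [NormedAddCommGroup Y]
  [NormedSpace ℝ Y] {a b C K c : ℝ} {z v : ℝ → X}

theorem intervalIntegrable (h : HasW11Deriv a b z v) {s t : ℝ} (hs : s ∈ Icc a b)
    (ht : t ∈ Icc a b) : IntervalIntegrable v volume s t :=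
  h.1.mono_set ((uIcc_subset_Icc hs ht).trans Icc_subset_uIcc)

theorem sub_eq_integral (h : HasW11Deriv a b z v) {s t : ℝ} (hs : s ∈ Icc a b)
    (ht : t ∈ Icc a b) : z t - z s = ∫ r in s..t, v r := by
  have ha : a ∈ Icc a b := left_mem_Icc.2 (hs.1.trans hs.2)
  rw [h.2 t ht, h.2 s hs, add_sub_add_left_eq_sub,
    intervalIntegral.integral_interval_sub_left (h.intervalIntegrable ha ht)
      (h.intervalIntegrable ha hs)]

theorem congr_ae {v' : ℝ → X} (h : HasW11Deriv a b z v) (hab : a ≤ b)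
    (hv : v =ᵐ[volume.restrict (Icc a b)] v') : HasW11Deriv a b z v' := by
  have hv' : v =ᵐ[volume.restrict (Ioc a b)] v' :=
    ae_restrict_of_ae_restrict_of_subset Ioc_subset_Icc_self hv
  refine ⟨h.1.congr_ae (by rwa [uIoc_of_le hab]), fun t ht => ?_⟩
  rw [h.2 t ht]
  congr 1
  refine intervalIntegral.integral_congr_ae_restrict ?_
  rw [uIoc_of_le ht.1]
  exact ae_restrict_of_ae_restrict_of_subset (Ioc_subset_Ioc_right ht.2) hv'

theorem sub {w r : ℝ → X} (h : HasW11Deriv a b z v) (h' : HasW11Deriv a b w r) :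
    HasW11Deriv a b (fun t => z t - w t) (fun t => v t - r t) := by
  refine ⟨h.1.sub h'.1, fun t ht => ?_⟩
  have ha : a ∈ Icc a b := left_mem_Icc.2 (ht.1.trans ht.2)
  beta_reduce
  rw [intervalIntegral.integral_sub (h.intervalIntegrable ha ht) (h'.intervalIntegrable ha ht),
    h.2 t ht, h'.2 t ht]
  abel

theorem clm_comp [CompleteSpace X] [CompleteSpace Y] (h : HasW11Deriv a b z v) (L : X →L[ℝ] Y) :
    HasW11Deriv a b (fun t => L (z t)) (fun t => L (v t)) := by
  refine ⟨⟨L.integrable_comp h.1.1, L.integrable_comp h.1.2⟩, fun t ht => ?_⟩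
  have ha : a ∈ Icc a b := left_mem_Icc.2 (ht.1.trans ht.2)
  beta_reduce
  rw [h.2 t ht, map_add, L.intervalIntegral_comp_comm (h.intervalIntegrable ha ht)]

theorem prodMk [CompleteSpace X] [CompleteSpace Y] {w r : ℝ → Y}
    (h : HasW11Deriv a b z v) (h' : HasW11Deriv a b w r) :
    HasW11Deriv a b (fun t => (z t, w t)) (fun t => (v t, r t)) := by
  refine ⟨⟨h.1.1.prodMk h'.1.1, h.1.2.prodMk h'.1.2⟩, fun t ht => ?_⟩
  have ha : a ∈ Icc a b := left_mem_Icc.2 (ht.1.trans ht.2)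
  have hi := h.intervalIntegrable ha ht
  have hi' := h'.intervalIntegrable ha ht
  have hp : IntervalIntegrable (fun t => (v t, r t)) volume a t :=
    ⟨hi.1.prodMk hi'.1, hi.2.prodMk hi'.2⟩
  have hfst := (ContinuousLinearMap.fst ℝ X Y).intervalIntegral_comp_comm hp
  have hsnd := (ContinuousLinearMap.snd ℝ X Y).intervalIntegral_comp_comm hp
  simp only [ContinuousLinearMap.coe_fst', ContinuousLinearMap.coe_snd'] at hfst hsnd
  ext1
  · simpa only [Prod.fst_add, ← hfst] using h.2 t ht
  · simpa only [Prod.snd_add, ← hsnd] using h'.2 t ht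

theorem reverse (h : HasW11Deriv a b z v) (hab : a ≤ b) :
    HasW11Deriv a b (fun t => z (a + b - t)) (fun t => -v (a + b - t)) := by
  refine ⟨?_, fun t ht => ?_⟩
  · have := h.1.comp_sub_left (a + b)
    simp only [add_sub_cancel_left, add_sub_cancel_right] at this
    exact this.symm.neg
  · have hmem : a + b - t ∈ Icc a b := ⟨by linarith [ht.2], by linarith [ht.1]⟩
    have := h.sub_eq_integral hmem (right_mem_Icc.2 hab)
    rw [intervalIntegral.integral_neg, intervalIntegral.integral_comp_sub_left]
    simp only [add_sub_cancel_left]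
    rw [← this]
    abel

theorem continuousOn (h : HasW11Deriv a b z v) : ContinuousOn z (Icc a b) := by
  rcases lt_or_ge b a with hba | hab
  · simp [Icc_eq_empty hba.not_ge]
  · have hprim := intervalIntegral.continuousOn_primitive_interval' h.1 left_mem_uIcc
    rw [uIcc_of_le hab] at hprim
    exact (continuousOn_const.add hprim).congr h.2

theorem norm_sub_le (h : HasW11Deriv a b z v) (hC : ∀ t ∈ Icc a b, ‖v t‖ ≤ C) {s t : ℝ}
    (hs : s ∈ Icc a b) (ht : t ∈ Icc a b) : ‖z t - z s‖ ≤ C * |t - s| := by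
  rw [h.sub_eq_integral hs ht]
  exact intervalIntegral.norm_integral_le_of_norm_le_const fun r hr =>
    hC r (uIcc_subset_Icc hs ht (uIoc_subset_uIcc hr))

theorem lipschitzOnWith (h : HasW11Deriv a b z v) (hC : ∀ t ∈ Icc a b, ‖v t‖ ≤ C) :
    LipschitzOnWith C.toNNReal z (Icc a b) := by
  refine LipschitzOnWith.of_dist_le_mul fun s hs t ht => ?_
  rw [dist_eq_norm, dist_eq_norm]
  exact (h.norm_sub_le hC ht hs).trans
    (mul_le_mul_of_nonneg_right (Real.le_coe_toNNReal C) (abs_nonneg _))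

theorem ae_hasDerivAt [CompleteSpace X] (h : HasW11Deriv a b z v) :
    ∀ᵐ t, t ∈ Ioo a b → HasDerivAt z (v t) t := by
  filter_upwards [h.1.ae_hasDerivAt_integral] with t ht htab
  have hab : a ≤ b := (htab.1.trans htab.2).le
  rw [uIcc_of_le hab] at ht
  refine ((ht (Ioo_subset_Icc_self htab) a (left_mem_Icc.2 hab)).const_add
    (z a)).congr_of_eventuallyEq ?_
  filter_upwards [Icc_mem_nhds htab.1 htab.2] with s hs using h.2 s hs

theorem of_lipschitzOnWith {f : ℝ → ℝ} {L : NNReal} (hab : a ≤ b)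
    (hf : LipschitzOnWith L f (Icc a b)) : HasW11Deriv a b f (deriv f) := by
  have hac : ∀ t ∈ Icc a b, AbsolutelyContinuousOnInterval f a t := fun t ht =>
    (hf.mono (uIcc_subset_Icc (left_mem_Icc.2 hab) ht)).absolutelyContinuousOnInterval
  refine ⟨(hac b (right_mem_Icc.2 hab)).intervalIntegrable_deriv, fun t ht => ?_⟩
  rw [(hac t ht).integral_deriv_eq_sub, add_sub_cancel]

theorem fderiv_comp [CompleteSpace X] {F : X → ℝ} (h : HasW11Deriv a b z v) (hab : a ≤ b)
    (hC : ∀ t ∈ Icc a b, ‖v t‖ ≤ C) (hF : ∀ t ∈ Icc a b, ContDiffAt ℝ 1 F (z t)) :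
    HasW11Deriv a b (fun t => F (z t)) (fun t => fderiv ℝ F (z t) (v t)) := by
  have hloc : LocallyLipschitzOn (z '' Icc a b) F := by
    rintro _ ⟨t, ht, rfl⟩
    obtain ⟨L, s, hs, hL⟩ := (hF t ht).exists_lipschitzOnWith
    exact ⟨L, s, mem_nhdsWithin_of_mem_nhds hs, hL⟩
  obtain ⟨L, hL⟩ := hloc.exists_lipschitzOnWith_of_compact
    (isCompact_Icc.image_of_continuousOn h.continuousOn)
  refine (of_lipschitzOnWith hab (hL.comp (h.lipschitzOnWith hC) (mapsTo_image _ _))).congr_ae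
    hab ?_
  rw [EventuallyEq, ← restrict_Ioo_eq_restrict_Icc, ae_restrict_iff' measurableSet_Ioo]
  filter_upwards [h.ae_hasDerivAt] with t ht htab
  have hFt := (hF t (Ioo_subset_Icc_self htab)).differentiableAt one_ne_zero
  exact (hFt.hasFDerivAt.comp_hasDerivAt t (ht htab)).deriv

theorem norm_le_mul_exp (h : HasW11Deriv a b z v) (hK : 0 ≤ K) (hc : 0 ≤ c)
    (hv : ∀ᵐ t ∂volume.restrict (Icc a b), ‖v t‖ ≤ K * ‖z t‖ + c) :
    ∀ t ∈ Icc a b, ‖z t‖ ≤ (‖z a‖ + c * (b - a)) * Real.exp (K * (b - a)) := by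
  have hgronwall : ∀ t ∈ Icc a b, ‖z t‖ ≤ ‖z a‖ + c * (b - a) + K * ∫ s in a..t, ‖z s‖ := by
    intro t ht
    have hz : IntervalIntegrable (fun s => ‖z s‖) volume a t :=
      (h.continuousOn.norm.mono (Icc_subset_Icc_right ht.2)).intervalIntegrable_of_Icc ht.1
    have hv' : ∀ᵐ s, s ∈ Ioc a t → ‖v s‖ ≤ K * ‖z s‖ + c := by
      filter_upwards [(ae_restrict_iff' measurableSet_Icc).1 hv] with s hs hst
      exact hs ⟨hst.1.le, hst.2.trans ht.2⟩
    have hint := intervalIntegral.norm_integral_le_of_norm_le ht.1 hv'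
      ((hz.const_mul K).add intervalIntegrable_const)
    rw [intervalIntegral.integral_add (hz.const_mul K) intervalIntegrable_const,
      intervalIntegral.integral_const_mul, intervalIntegral.integral_const, smul_eq_mul] at hint
    have hct : (t - a) * c ≤ c * (b - a) := by nlinarith [ht.2]
    rw [h.2 t ht]
    linarith [norm_add_le (z a) (∫ s in a..t, v s)]
  intro t ht
  have hab : 0 ≤ b - a := sub_nonneg.2 (ht.1.trans ht.2)
  refine (le_mul_exp_of_le_add_integral hK h.continuousOn.norm hgronwall t ht).trans ?_
  have := ht.2
  gcongr

theorem eq_zero_of_norm_le (h : HasW11Deriv a b z v) (hK : 0 ≤ K)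
    (hv : ∀ᵐ t ∂volume.restrict (Icc a b), ‖v t‖ ≤ K * ‖z t‖) (hza : z a = 0) :
    ∀ t ∈ Icc a b, z t = 0 := fun t ht => by
  simpa [hza] using h.norm_le_mul_exp hK le_rfl (by simpa using hv) t ht

end HasW11Deriv

/-! ### Carathéodory equations -/

section Picard

variable {X : Type*} [NormedAddCommGroup X]

/-- A time-dependent field `G` on `[a, b]` that is `K`-Lipschitz in the state and integrable along
every continuous curve: the hypotheses under which `ẋ = G(t, x)` is well posed in `W^{1,1}`. -/
structure IsCaratheodoryField (a b : ℝ) (K : NNReal) (G : ℝ → X → X) : Prop where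
  lipschitzWith : ∀ s ∈ Icc a b, LipschitzWith K (G s)
  intervalIntegrable_comp : ∀ y : ℝ → X, ContinuousOn y (Icc a b) →
    IntervalIntegrable (fun s => G s (y s)) volume a b

namespace IsCaratheodoryField

variable {a b : ℝ} {K : NNReal} {G : ℝ → X → X}

theorem of_norm_zero_le {C : ℝ} (hab : a ≤ b)
    (hlip : ∀ s ∈ Icc a b, LipschitzWith K (G s)) (hC : ∀ s ∈ Icc a b, ‖G s 0‖ ≤ C)
    (hmeas : ∀ y : ℝ → X, ContinuousOn y (Icc a b) →
      AEStronglyMeasurable (fun s => G s (y s)) (volume.restrict (Icc a b))) :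
    IsCaratheodoryField a b K G := by
  refine ⟨hlip, fun y hy => ?_⟩
  obtain ⟨M, hM⟩ := isCompact_Icc.exists_bound_of_continuousOn hy
  refine intervalIntegrable_of_norm_le hab (C := C + K * M) (hmeas y hy) fun s hs => ?_
  refine (norm_le_norm_add_norm_sub' _ (G s 0)).trans (add_le_add (hC s hs) ?_)
  refine ((hlip s hs).norm_sub_le _ _).trans (mul_le_mul_of_nonneg_left ?_ K.2)
  simpa using hM s hs

theorem reverse (hG : IsCaratheodoryField a b K G) :
    IsCaratheodoryField a b K fun s y => -G (a + b - s) y := by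
  have hσ : ∀ s ∈ Icc a b, a + b - s ∈ Icc a b := fun s hs =>
    ⟨by linarith [hs.2], by linarith [hs.1]⟩
  refine ⟨fun s hs => (hG.1 _ (hσ s hs)).neg, fun y hy => ?_⟩
  have hint := (hG.2 (fun s => y (a + b - s))
    (hy.comp (by fun_prop) hσ)).comp_sub_left (a + b)
  simp only [sub_sub_cancel, add_sub_cancel_left, add_sub_cancel_right] at hint
  exact hint.symm.neg

end IsCaratheodoryField

variable [NormedSpace ℝ X]

/-- The Picard iterates of the integral equation `x(t) = x₀ + ∫_a^t G(s, x(s)) ds`. -/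
noncomputable def picardIterate (a : ℝ) (G : ℝ → X → X) (x₀ : X) : ℕ → ℝ → X
  | 0 => fun _ => x₀
  | k + 1 => fun t => x₀ + ∫ s in a..t, G s (picardIterate a G x₀ k s)

theorem integral_pow_div_factorial (a t K C : ℝ) (k : ℕ) :
    ∫ s in a..t, K * (C * ((K * (s - a)) ^ k / k.factorial)) =
      C * ((K * (t - a)) ^ (k + 1) / (k + 1).factorial) := by
  have hd : ∀ s ∈ uIcc a t, HasDerivAt
      (fun s => C * ((K * (s - a)) ^ (k + 1) / (k + 1).factorial))
      (K * (C * ((K * (s - a)) ^ k / k.factorial))) s := by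
    intro s _
    have hlin : HasDerivAt (fun s => K * (s - a)) K s := by
      simpa using ((hasDerivAt_id s).sub_const a).const_mul K
    refine HasDerivAt.congr_deriv
      (((hlin.pow (k + 1)).div_const ((k + 1).factorial : ℝ)).const_mul C) ?_
    have : (k.factorial : ℝ) ≠ 0 := by positivity
    have : (((k + 1 : ℕ) : ℝ)) ≠ 0 := by positivity
    rw [Nat.factorial_succ, Nat.cast_mul, Nat.add_sub_cancel]
    field_simp
  rw [intervalIntegral.integral_eq_sub_of_hasDerivAt hd
    (Continuous.intervalIntegrable (by fun_prop) _ _)]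
  simp

namespace IsCaratheodoryField

variable {a b : ℝ} {K : NNReal} {G : ℝ → X → X} {x₀ : X}

theorem hasW11Deriv_picardIterate_succ (hG : IsCaratheodoryField a b K G) (k : ℕ) :
    HasW11Deriv a b (picardIterate a G x₀ (k + 1)) (fun s => G s (picardIterate a G x₀ k s)) := by
  induction k with
  | zero => exact ⟨hG.2 _ continuousOn_const, fun t _ => by simp [picardIterate]⟩
  | succ k ih => exact ⟨hG.2 _ ih.continuousOn, fun t _ => by simp [picardIterate]⟩

theorem continuousOn_picardIterate (hG : IsCaratheodoryField a b K G) (k : ℕ) :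
    ContinuousOn (picardIterate a G x₀ k) (Icc a b) := by
  cases k with
  | zero => exact continuousOn_const
  | succ k => exact (hG.hasW11Deriv_picardIterate_succ k).continuousOn

theorem norm_picardIterate_succ_sub_le (hG : IsCaratheodoryField a b K G) {C : ℝ}
    (hC : ∀ t ∈ Icc a b, ‖picardIterate a G x₀ 1 t - x₀‖ ≤ C) (k : ℕ) :
    ∀ t ∈ Icc a b, ‖picardIterate a G x₀ (k + 1) t - picardIterate a G x₀ k t‖ ≤
      C * ((K * (t - a)) ^ k / k.factorial) := by
  induction k with
  | zero => intro t ht; simpa [picardIterate] using hC t ht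
  | succ k ih =>
    intro t ht
    have ha : a ∈ Icc a b := left_mem_Icc.2 (ht.1.trans ht.2)
    have hdiff : picardIterate a G x₀ (k + 1 + 1) t - picardIterate a G x₀ (k + 1) t =
        ∫ s in a..t, (G s (picardIterate a G x₀ (k + 1) s) - G s (picardIterate a G x₀ k s)) := by
      rw [intervalIntegral.integral_sub
        ((hG.hasW11Deriv_picardIterate_succ (k + 1)).intervalIntegrable ha ht)
        ((hG.hasW11Deriv_picardIterate_succ k).intervalIntegrable ha ht)]
      simp [picardIterate]
    rw [hdiff, ← integral_pow_div_factorial]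
    refine intervalIntegral.norm_integral_le_of_norm_le ht.1 (ae_of_all _ fun s hs => ?_)
      (Continuous.intervalIntegrable (by fun_prop) _ _)
    have hs' : s ∈ Icc a b := ⟨hs.1.le, hs.2.trans ht.2⟩
    exact ((hG.1 s hs').norm_sub_le _ _).trans (mul_le_mul_of_nonneg_left (ih s hs') K.2)

theorem exists_tendstoUniformlyOn_picardIterate [CompleteSpace X]
    (hG : IsCaratheodoryField a b K G) (x₀ : X) :
    ∃ x, TendstoUniformlyOn (picardIterate a G x₀) x atTop (Icc a b) := by
  obtain ⟨C, hC⟩ := isCompact_Icc.exists_bound_of_continuousOn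
    ((hG.continuousOn_picardIterate (x₀ := x₀) 1).sub continuousOn_const)
  have hbound : ∀ k, ∀ t ∈ Icc a b,
      ‖picardIterate a G x₀ (k + 1) t - picardIterate a G x₀ k t‖ ≤
        C * ((K * (b - a)) ^ k / k.factorial) := by
    intro k t ht
    have hC0 : 0 ≤ C := (norm_nonneg _).trans (hC t ht)
    refine (hG.norm_picardIterate_succ_sub_le hC k t ht).trans ?_
    have := sub_nonneg.2 ht.1
    have := ht.2
    gcongr
  have hseries := tendstoUniformlyOn_tsum_nat
    ((Real.summable_pow_div_factorial (K * (b - a))).mul_left C) hbound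
  have hconst : TendstoUniformlyOn (fun (_ : ℕ) (_ : ℝ) => x₀) (fun _ => x₀) atTop (Icc a b) :=
    fun u hu => Eventually.of_forall fun _ _ _ => refl_mem_uniformity hu
  refine ⟨_, (hconst.add hseries).congr (Eventually.of_forall fun k t _ => ?_)⟩
  simp only [Pi.add_apply]
  rw [Finset.sum_range_sub (fun i => picardIterate a G x₀ i t)]
  simp [picardIterate]

theorem tendsto_integral_comp (hG : IsCaratheodoryField a b K G) {y : ℕ → ℝ → X} {x : ℝ → X}
    (hy : ∀ k, ContinuousOn (y k) (Icc a b)) (hx : TendstoUniformlyOn y x atTop (Icc a b))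
    {t : ℝ} (ht : t ∈ Icc a b) :
    Tendsto (fun k => ∫ s in a..t, G s (y k s)) atTop (𝓝 (∫ s in a..t, G s (x s))) := by
  have hsub : uIoc a t ⊆ Icc a b := by
    rw [uIoc_of_le ht.1]
    exact fun s hs => ⟨hs.1.le, hs.2.trans ht.2⟩
  have hint : ∀ z : ℝ → X, ContinuousOn z (Icc a b) →
      IntervalIntegrable (fun s => G s (z s)) volume a t := fun z hz =>
    (hG.2 z hz).mono_set ((uIcc_subset_Icc (left_mem_Icc.2 (ht.1.trans ht.2)) ht).trans
      Icc_subset_uIcc)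
  have hxc : ContinuousOn x (Icc a b) := hx.continuousOn (Frequently.of_forall hy)
  refine intervalIntegral.tendsto_integral_filter_of_dominated_convergence
    (fun s => ‖G s (x s)‖ + K) (Eventually.of_forall fun k => ?_) ?_
    ((hint x hxc).norm.add intervalIntegrable_const) (ae_of_all _ fun s hs => ?_)
  · exact (hint _ (hy k)).aestronglyMeasurable_restrict_uIoc
  · filter_upwards [Metric.tendstoUniformlyOn_iff.1 hx 1 one_pos] with k hk
    refine ae_of_all _ fun s hs => ?_
    have hdist : ‖y k s - x s‖ ≤ 1 := by
      rw [← dist_eq_norm, dist_comm]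
      exact (hk s (hsub hs)).le
    refine (norm_le_norm_add_norm_sub' _ _).trans (add_le_add_right ?_ _)
    exact ((hG.1 s (hsub hs)).norm_sub_le _ _).trans (mul_le_of_le_one_right K.2 hdist)
  · exact ((hG.1 s (hsub hs)).continuous.tendsto _).comp (hx.tendsto_at (hsub hs))

theorem exists_hasW11Deriv [CompleteSpace X] (hG : IsCaratheodoryField a b K G) (hab : a ≤ b)
    (x₀ : X) :
    ∃ x : ℝ → X, x a = x₀ ∧ HasW11Deriv a b x (fun s => G s (x s)) ∧
      ∀ t ∈ Icc a b, Tendsto (fun k => picardIterate a G x₀ k t) atTop (𝓝 (x t)) := by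
  obtain ⟨x, hx⟩ := hG.exists_tendstoUniformlyOn_picardIterate x₀
  have hcont := hG.continuousOn_picardIterate (x₀ := x₀)
  have hfix : ∀ t ∈ Icc a b, x t = x₀ + ∫ s in a..t, G s (x s) := fun t ht =>
    tendsto_nhds_unique ((hx.tendsto_at ht).comp (tendsto_add_atTop_nat 1))
      ((hG.tendsto_integral_comp hcont hx ht).const_add x₀)
  have hxa : x a = x₀ := by simpa using hfix a (left_mem_Icc.2 hab)
  refine ⟨x, hxa, ⟨hG.2 x (hx.continuousOn (Frequently.of_forall hcont)), ?_⟩,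
    fun t ht => hx.tendsto_at ht⟩
  rwa [hxa]

theorem exists_hasW11Deriv_right [CompleteSpace X] (hG : IsCaratheodoryField a b K G)
    (hab : a ≤ b) (x₁ : X) :
    ∃ x : ℝ → X, x b = x₁ ∧ HasW11Deriv a b x (fun s => G s (x s)) := by
  obtain ⟨x, hxa, hx, -⟩ := hG.reverse.exists_hasW11Deriv hab x₁
  refine ⟨fun t => x (a + b - t), by simpa using hxa, ?_⟩
  simpa only [sub_sub_cancel, neg_neg] using hx.reverse hab

theorem eqOn (hG : IsCaratheodoryField a b K G) {x y : ℝ → X}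
    (hx : HasW11Deriv a b x fun s => G s (x s)) (hy : HasW11Deriv a b y fun s => G s (y s))
    (hxy : x a = y a) : EqOn x y (Icc a b) := fun t ht => by
  refine sub_eq_zero.1 ((hx.sub hy).eq_zero_of_norm_le K.2 ?_ (sub_eq_zero.2 hxy) t ht)
  filter_upwards [ae_restrict_mem measurableSet_Icc] with s hs
  exact (hG.1 s hs).norm_sub_le _ _

theorem eqOn_of_eq_right (hG : IsCaratheodoryField a b K G) (hab : a ≤ b) {x y : ℝ → X}
    (hx : HasW11Deriv a b x fun s => G s (x s)) (hy : HasW11Deriv a b y fun s => G s (y s))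
    (hxy : x b = y b) : EqOn x y (Icc a b) := fun t ht => by
  have hrev := hG.reverse.eqOn (hx.reverse hab) (hy.reverse hab)
    (by simpa only [add_sub_cancel_left] using hxy)
  simpa only [sub_sub_cancel] using
    hrev (x := a + b - t) ⟨by linarith [ht.2], by linarith [ht.1]⟩

theorem tendsto_picardIterate [CompleteSpace X] (hG : IsCaratheodoryField a b K G) {x : ℝ → X}
    (hx : HasW11Deriv a b x fun s => G s (x s)) {t : ℝ} (ht : t ∈ Icc a b) :
    Tendsto (fun k => picardIterate a G (x a) k t) atTop (𝓝 (x t)) := by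
  obtain ⟨y, hya, hy, hlim⟩ := hG.exists_hasW11Deriv (ht.1.trans ht.2) (x a)
  rw [hG.eqOn hx hy hya.symm ht]
  exact hlim t ht

end IsCaratheodoryField

end Picard

section Parameter

variable {Ω E : Type*} [MeasurableSpace Ω] {μ : Measure Ω} [NormedAddCommGroup E] {a b : ℝ}

theorem aestronglyMeasurable_uncurry_of_continuousOn (hab : a ≤ b) {x : ℝ → Ω → E}
    (hx : ∀ t ∈ Icc a b, AEStronglyMeasurable (x t) μ)
    (hc : ∀ ω, ContinuousOn (fun t => x t ω) (Icc a b)) :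
    AEStronglyMeasurable (fun z : ℝ × Ω => x z.1 z.2) ((volume.restrict (Icc a b)).prod μ) := by
  have hproj : StronglyMeasurable (projIcc a b hab) := continuous_projIcc.stronglyMeasurable
  set π := hproj.approx
  have hsimple : ∀ k, AEStronglyMeasurable (fun z : ℝ × Ω => x (π k z.1) z.2)
      ((volume.restrict (Icc a b)).prod μ) := by
    intro k
    have hsum : (fun z : ℝ × Ω => x (π k z.1) z.2) = fun z => ∑ c ∈ (π k).range,
        indicator (Prod.fst ⁻¹' (π k ⁻¹' {c})) (fun z : ℝ × Ω => x c z.2) z := by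
      ext1 z
      rw [Finset.sum_eq_single (π k z.1)]
      · rw [indicator_of_mem (by simp)]
      · intro c _ hc
        exact indicator_of_notMem (by simpa using hc.symm) _
      · intro h
        exact absurd (SimpleFunc.mem_range_self _ _) h
    rw [hsum]
    exact Finset.aestronglyMeasurable_fun_sum _ fun c _ =>
      ((hx c c.2).comp_snd).indicator (measurable_fst ((π k).measurableSet_fiber c))
  refine aestronglyMeasurable_of_tendsto_ae atTop hsimple ?_
  have hae : ∀ᵐ z ∂(volume.restrict (Icc a b)).prod μ, z.1 ∈ Icc a b :=
    Measure.quasiMeasurePreserving_fst.ae (ae_restrict_mem measurableSet_Icc)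
  filter_upwards [hae] with z hz
  have hlim : Tendsto (fun k => ((π k z.1 : Icc a b) : ℝ)) atTop (𝓝[Icc a b] z.1) := by
    refine tendsto_nhdsWithin_iff.2 ⟨?_, Eventually.of_forall fun k => (π k z.1).2⟩
    have := (continuous_subtype_val.tendsto _).comp (hproj.tendsto_approx z.1)
    rwa [projIcc_of_mem hab hz] at this
  exact (hc z.2 z.1 hz).tendsto.comp hlim

variable [SFinite μ] [NormedSpace ℝ E] {K : NNReal} {G : ℝ → E → Ω → E}

theorem aestronglyMeasurable_picardIterate (hab : a ≤ b) {φ : Ω → E}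
    (hφ : AEStronglyMeasurable φ μ) (hG : ∀ ω, IsCaratheodoryField a b K fun s x => G s x ω)
    (hmeas : ∀ y : ℝ → Ω → E, AEStronglyMeasurable (fun z : ℝ × Ω => y z.1 z.2)
        ((volume.restrict (Icc a b)).prod μ) →
      AEStronglyMeasurable (fun z : ℝ × Ω => G z.1 (y z.1 z.2) z.2)
        ((volume.restrict (Icc a b)).prod μ)) (k : ℕ) :
    ∀ t ∈ Icc a b,
      AEStronglyMeasurable (fun ω => picardIterate a (fun s x => G s x ω) (φ ω) k t) μ := by
  induction k with
  | zero => exact fun _ _ => hφ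
  | succ k ih =>
    intro t ht
    have hsub : Ioc a t ⊆ Icc a b := fun s hs => ⟨hs.1.le, hs.2.trans ht.2⟩
    have hjoint := (hmeas _ (aestronglyMeasurable_uncurry_of_continuousOn hab ih
      fun ω => (hG ω).continuousOn_picardIterate k)).mono_measure
        (Measure.prod_mono (Measure.restrict_mono hsub le_rfl) le_rfl)
    have hint := hjoint.prod_swap.integral_prod_right'
    refine hφ.add (hint.congr (ae_of_all _ fun ω => ?_))
    simp only [Prod.fst_swap, Prod.snd_swap, intervalIntegral.integral_of_le ht.1]

theorem aestronglyMeasurable_of_hasW11Deriv [CompleteSpace E] (hab : a ≤ b) {x : ℝ → Ω → E}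
    (hxa : AEStronglyMeasurable (x a) μ)
    (hG : ∀ ω, IsCaratheodoryField a b K fun s x => G s x ω)
    (hmeas : ∀ y : ℝ → Ω → E, AEStronglyMeasurable (fun z : ℝ × Ω => y z.1 z.2)
        ((volume.restrict (Icc a b)).prod μ) →
      AEStronglyMeasurable (fun z : ℝ × Ω => G z.1 (y z.1 z.2) z.2)
        ((volume.restrict (Icc a b)).prod μ))
    (hx : ∀ ω, HasW11Deriv a b (fun t => x t ω) fun t => G t (x t ω) ω) :
    ∀ t ∈ Icc a b, AEStronglyMeasurable (x t) μ := fun t ht =>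
  aestronglyMeasurable_of_tendsto_ae atTop
    (fun k => aestronglyMeasurable_picardIterate hab hxa hG hmeas k t ht)
    (ae_of_all _ fun ω => (hG ω).tendsto_picardIterate (hx ω) ht)

theorem measurePreserving_reverse (a b : ℝ) :
    MeasurePreserving (fun t => a + b - t) (volume.restrict (Icc a b))
      (volume.restrict (Icc a b)) := by
  have h := (volume.measurePreserving_sub_left (a + b)).restrict_preimage
    (measurableSet_Icc (a := a) (b := b))
  simpa only [preimage_const_sub_Icc, add_sub_cancel_left, add_sub_cancel_right] using h

theorem aestronglyMeasurable_of_hasW11Deriv_right [CompleteSpace E] (hab : a ≤ b)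
    {x : ℝ → Ω → E} (hxb : AEStronglyMeasurable (x b) μ)
    (hG : ∀ ω, IsCaratheodoryField a b K fun s x => G s x ω)
    (hmeas : ∀ y : ℝ → Ω → E, AEStronglyMeasurable (fun z : ℝ × Ω => y z.1 z.2)
        ((volume.restrict (Icc a b)).prod μ) →
      AEStronglyMeasurable (fun z : ℝ × Ω => G z.1 (y z.1 z.2) z.2)
        ((volume.restrict (Icc a b)).prod μ))
    (hx : ∀ ω, HasW11Deriv a b (fun t => x t ω) fun t => G t (x t ω) ω) :
    ∀ t ∈ Icc a b, AEStronglyMeasurable (x t) μ := by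
  intro t ht
  have hpres := (measurePreserving_reverse a b).prod (MeasurePreserving.id μ)
  have hrev := aestronglyMeasurable_of_hasW11Deriv hab (x := fun t ω => x (a + b - t) ω)
    (by simpa using hxb) (fun ω => (hG ω).reverse)
    (fun y hy => by
      have := (hmeas (fun t ω => y (a + b - t) ω)
        (hy.comp_measurePreserving hpres)).comp_measurePreserving hpres
      simp only [Function.comp_def, Prod.map_fst, Prod.map_snd, id, sub_sub_cancel] at this
      exact this.neg)
    (fun ω => (hx ω).reverse hab) (a + b - t) ⟨by linarith [ht.2], by linarith [ht.1]⟩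
  simpa only [sub_sub_cancel] using hrev

end Parameter

/-! ### Measurable differentiation in a parameter -/

section DirectionalLimit

variable {Ω E G : Type*} [NormedAddCommGroup E] [NormedSpace ℝ E] [NormedAddCommGroup G]
  [NormedSpace ℝ G]

/-- The limit of the difference quotients of `F(·,ω)` at `x` in the direction `v` along the steps
`1/m`. Unlike `fderiv`, which vanishes off the set of differentiability, it is jointly measurable
as soon as `F` is. -/
noncomputable def dirLim (F : E → Ω → G) (x v : E) (ω : Ω) : G :=
  limUnder atTop fun m : ℕ => (m : ℝ) • (F (x + (m : ℝ)⁻¹ • v) ω - F x ω)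

theorem dirLim_eq_fderiv {F : E → Ω → G} {x : E} {ω : Ω}
    (h : DifferentiableAt ℝ (fun y => F y ω) x) (v : E) :
    dirLim F x v ω = fderiv ℝ (fun y => F y ω) x v := by
  refine Tendsto.limUnder_eq (h.hasFDerivAt.lim v ?_)
  simpa using tendsto_natCast_atTop_atTop (R := ℝ)

/-- The Lie bracket with directional limits in place of derivatives; it is jointly measurable and
agrees with the bracket wherever both fields are differentiable. -/
noncomputable def bracketLim (V W : E → Ω → E) (x : E) (ω : Ω) : E :=
  dirLim W x (V x ω) ω - dirLim V x (W x ω) ω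

theorem bracketLim_eq_lieBracket {V W : E → Ω → E} {x : E} {ω : Ω}
    (hV : DifferentiableAt ℝ (fun y => V y ω) x) (hW : DifferentiableAt ℝ (fun y => W y ω) x) :
    bracketLim V W x ω = VectorField.lieBracket ℝ (fun y => V y ω) (fun y => W y ω) x := by
  rw [bracketLim, dirLim_eq_fderiv hV, dirLim_eq_fderiv hW, VectorField.lieBracket]

variable [MeasurableSpace Ω] [MeasurableSpace E] [BorelSpace E] [SecondCountableTopology E]

section

variable [MeasurableSpace G] [BorelSpace G] [SecondCountableTopology G] [CompleteSpace G]

theorem measurable_dirLim {F : E → Ω → G} (hF : Measurable fun z : E × Ω => F z.1 z.2) :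
    Measurable fun z : E × E × Ω => dirLim F z.1 z.2.1 z.2.2 := by
  refine (StronglyMeasurable.limUnder fun m => Measurable.stronglyMeasurable ?_).measurable
  have hshift : Measurable fun z : E × E × Ω => F (z.1 + (m : ℝ)⁻¹ • z.2.1) z.2.2 :=
    hF.comp (by fun_prop : Measurable fun z : E × E × Ω => (z.1 + (m : ℝ)⁻¹ • z.2.1, z.2.2))
  have hbase : Measurable fun z : E × E × Ω => F z.1 z.2.2 :=
    hF.comp (by fun_prop : Measurable fun z : E × E × Ω => (z.1, z.2.2))
  exact (hshift.sub hbase).const_smul (m : ℝ)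

theorem aemeasurable_fderiv_apply {F : E → Ω → G} (hF : Measurable fun z : E × Ω => F z.1 z.2)
    {α : Type*} [MeasurableSpace α] {ν : Measure α} {y v : α → E} {ω : α → Ω}
    (hy : AEMeasurable y ν) (hv : AEMeasurable v ν) (hω : AEMeasurable ω ν)
    (hd : ∀ᵐ i ∂ν, DifferentiableAt ℝ (fun x => F x (ω i)) (y i)) :
    AEMeasurable (fun i => fderiv ℝ (fun x => F x (ω i)) (y i) (v i)) ν := by
  refine ((measurable_dirLim hF).comp_aemeasurable (hy.prodMk (hv.prodMk hω))).congr ?_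
  filter_upwards [hd] with i hi using dirLim_eq_fderiv hi (v i)

end

theorem measurable_bracketLim [CompleteSpace E] {V W : E → Ω → E}
    (hV : Measurable fun z : E × Ω => V z.1 z.2) (hW : Measurable fun z : E × Ω => W z.1 z.2) :
    Measurable fun z : E × Ω => bracketLim V W z.1 z.2 := by
  have hVW : Measurable fun z : E × Ω => dirLim W z.1 (V z.1 z.2) z.2 :=
    (measurable_dirLim hW).comp (g := fun z : E × E × Ω => dirLim W z.1 z.2.1 z.2.2)
      (f := fun z : E × Ω => (z.1, V z.1 z.2, z.2))
      (measurable_fst.prodMk (hV.prodMk measurable_snd))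
  have hWV : Measurable fun z : E × Ω => dirLim V z.1 (W z.1 z.2) z.2 :=
    (measurable_dirLim hV).comp (g := fun z : E × E × Ω => dirLim V z.1 z.2.1 z.2.2)
      (f := fun z : E × Ω => (z.1, W z.1 z.2, z.2))
      (measurable_fst.prodMk (hW.prodMk measurable_snd))
  exact hVW.sub hWV

end DirectionalLimit

theorem aemeasurable_of_forall_inner {α E : Type*} [MeasurableSpace α] {ν : Measure α}
    [NormedAddCommGroup E] [InnerProductSpace ℝ E] [FiniteDimensional ℝ E] [MeasurableSpace E]
    [BorelSpace E] {F : α → E} (h : ∀ v, AEMeasurable (fun s => inner ℝ v (F s)) ν) :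
    AEMeasurable F ν := by
  have hsum : F = fun s => ∑ i, inner ℝ (stdOrthonormalBasis ℝ E i) (F s) •
      stdOrthonormalBasis ℝ E i :=
    funext fun s => ((stdOrthonormalBasis ℝ E).sum_repr' (F s)).symm
  rw [hsum]
  exact Finset.aemeasurable_fun_sum _ fun i _ => (h _).smul_const _

/-! ### Arcs of the control system -/

namespace AffineProblem

variable {n : ℕ} {Ω : Type*} {P : AffineProblem n Ω}

/-- Growth and Lipschitz constants that serve for `f₀`, `f₁` and the dynamics at once. -/
structure UniformBounds (P : AffineProblem n Ω) (c K : NNReal) : Prop where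
  f₀_le : ∀ x ω, ‖P.f₀ x ω‖ ≤ c * (1 + ‖x‖)
  f₁_le : ∀ x ω, ‖P.f₁ x ω‖ ≤ c * (1 + ‖x‖)
  dyn_le : ∀ u ∈ Icc P.umin P.umax, ∀ x ω, ‖P.dyn x u ω‖ ≤ c * (1 + ‖x‖)
  f₀_lip : ∀ ω, LipschitzWith K fun x => P.f₀ x ω
  f₁_lip : ∀ ω, LipschitzWith K fun x => P.f₁ x ω
  dyn_lip : ∀ u ∈ Icc P.umin P.umax, ∀ ω, LipschitzWith K fun x => P.dyn x u ω

theorem norm_dyn_le {x : StateSpace n} {u : ℝ} {ω : Ω} :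
    ‖P.dyn x u ω‖ ≤ ‖P.f₀ x ω‖ + ‖u‖ * ‖P.f₁ x ω‖ :=
  (norm_add_le _ _).trans_eq (by rw [norm_smul])

theorem H0.exists_uniformBounds [MeasurableSpace Ω] (h0 : P.H0) :
    ∃ c K, P.UniformBounds c K := by
  obtain ⟨c₀, hc₀, growth₀⟩ := h0.growth_f₀
  obtain ⟨c₁, hc₁, growth₁⟩ := h0.growth_f₁
  obtain ⟨k₀, hk₀, lip₀⟩ := h0.lip_f₀
  obtain ⟨k₁, hk₁, lip₁⟩ := h0.lip_f₁
  lift c₀ to NNReal using hc₀.le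
  lift c₁ to NNReal using hc₁.le
  lift k₀ to NNReal using hk₀.le
  lift k₁ to NNReal using hk₁.le
  replace lip₀ ω : LipschitzWith k₀ fun x => P.f₀ x ω :=
    .of_dist_le_mul fun x y => by simpa only [dist_eq_norm] using lip₀ x y ω
  replace lip₁ ω : LipschitzWith k₁ fun x => P.f₁ x ω :=
    .of_dist_le_mul fun x y => by simpa only [dist_eq_norm] using lip₁ x y ω
  set D : NNReal := max ‖P.umin‖₊ ‖P.umax‖₊
  have hD : ∀ u ∈ Icc P.umin P.umax, ‖u‖₊ ≤ D := fun u hu => abs_le_max_abs_abs hu.1 hu.2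
  refine ⟨c₀ + (1 + D) * c₁, k₀ + (1 + D) * k₁,
    ⟨fun x ω => (growth₀ x ω).trans ?_, fun x ω => (growth₁ x ω).trans ?_, fun u hu x ω => ?_,
    fun ω => (lip₀ ω).weaken le_self_add, fun ω => (lip₁ ω).weaken ?_, fun u hu ω => ?_⟩⟩
  · gcongr
    exact_mod_cast le_self_add
  · gcongr
    exact_mod_cast (le_mul_of_one_le_left' le_self_add).trans le_add_self
  · calc ‖P.dyn x u ω‖ ≤ ‖P.f₀ x ω‖ + ‖u‖ * ‖P.f₁ x ω‖ := norm_dyn_le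
      _ ≤ c₀ * (1 + ‖x‖) + (1 + D) * (c₁ * (1 + ‖x‖)) := by
        gcongr
        exacts [growth₀ x ω, le_add_of_nonneg_of_le zero_le_one (hD u hu), growth₁ x ω]
      _ = ↑(c₀ + (1 + D) * c₁) * (1 + ‖x‖) := by push_cast; ring
  · exact (le_mul_of_one_le_left' le_self_add).trans le_add_self
  · refine ((lip₀ ω).add ((lipschitzWith_smul u).comp (lip₁ ω))).weaken ?_
    gcongr
    exact (hD u hu).trans le_add_self

/-- A control that is Borel measurable and takes its values in `[umin, umax]` everywhere. -/
def IsStrictControl (P : AffineProblem n Ω) (w : ℝ → ℝ) : Prop :=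
  Measurable w ∧ ∀ t, w t ∈ Icc P.umin P.umax

theorem IsStrictControl.isAdmissibleControl {w : ℝ → ℝ} (h : P.IsStrictControl w) :
    P.IsAdmissibleControl w :=
  ⟨h.1.aestronglyMeasurable, ae_of_all _ h.2⟩

theorem IsAdmissibleControl.exists_isStrictControl {u : ℝ → ℝ} (h : P.IsAdmissibleControl u) :
    ∃ w, P.IsStrictControl w ∧ u =ᵐ[volume.restrict (Icc P.t₀ P.T)] w := by
  refine ⟨fun t => projIcc P.umin P.umax P.control_lt.le (h.1.mk u t),
    ⟨?_, fun t => Subtype.coe_prop _⟩, ?_⟩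
  · exact measurable_subtype_coe.comp
      (continuous_projIcc.measurable.comp h.1.stronglyMeasurable_mk.measurable)
  · filter_upwards [h.1.ae_eq_mk, h.2] with t ht htU
    rw [← ht, projIcc_of_mem _ htU]

theorem IsAdmissible.congr_control {u w : ℝ → ℝ} {x : ℝ → Ω → StateSpace n}
    (h : P.IsAdmissible u x) (hw : P.IsStrictControl w)
    (huw : u =ᵐ[volume.restrict (Icc P.t₀ P.T)] w) : P.IsAdmissible w x := by
  refine ⟨hw.isAdmissibleControl, fun ω => ⟨(h.2 ω).1, (h.2 ω).2.congr_ae P.time_lt.le ?_⟩⟩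
  filter_upwards [huw] with t ht
  rw [ht]

theorem IsAdmissible.continuousOn {u : ℝ → ℝ} {x : ℝ → Ω → StateSpace n}
    (h : P.IsAdmissible u x) (ω : Ω) : ContinuousOn (fun t => x t ω) (Icc P.t₀ P.T) :=
  (h.2 ω).2.continuousOn

section Measurability

variable [MeasurableSpace Ω] {w : ℝ → ℝ}

theorem H0.measurable_f₀ (h0 : P.H0) : Measurable fun z : StateSpace n × Ω => P.f₀ z.1 z.2 := by
  obtain ⟨c, K, hb⟩ := h0.exists_uniformBounds
  exact measurable_uncurry_of_continuous_of_measurable (fun ω => (hb.f₀_lip ω).continuous)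
    h0.meas_f₀

theorem H0.measurable_f₁ (h0 : P.H0) : Measurable fun z : StateSpace n × Ω => P.f₁ z.1 z.2 := by
  obtain ⟨c, K, hb⟩ := h0.exists_uniformBounds
  exact measurable_uncurry_of_continuous_of_measurable (fun ω => (hb.f₁_lip ω).continuous)
    h0.meas_f₁

theorem H0.aemeasurable_dyn (h0 : P.H0) {α : Type*} [MeasurableSpace α] {ν : Measure α}
    {y : α → StateSpace n} {s : α → ℝ} {ω : α → Ω} (hy : AEMeasurable y ν)
    (hs : AEMeasurable s ν) (hω : AEMeasurable ω ν) :
    AEMeasurable (fun i => P.dyn (y i) (s i) (ω i)) ν :=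
  (h0.measurable_f₀.comp_aemeasurable (hy.prodMk hω)).add
    (hs.smul (h0.measurable_f₁.comp_aemeasurable (hy.prodMk hω)))

theorem H0.exists_isCaratheodoryField_dyn (h0 : P.H0) (hw : P.IsStrictControl w) :
    ∃ K, ∀ ω, IsCaratheodoryField P.t₀ P.T K fun s y => P.dyn y (w s) ω := by
  obtain ⟨c, K, hb⟩ := h0.exists_uniformBounds
  refine ⟨K, fun ω => .of_norm_zero_le P.time_lt.le (fun s _ => hb.dyn_lip _ (hw.2 s) ω)
    (C := c) (fun s _ => ?_) fun y hy => ?_⟩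
  · simpa using hb.dyn_le _ (hw.2 s) 0 ω
  · exact (h0.aemeasurable_dyn (hy.aemeasurable measurableSet_Icc) hw.1.aemeasurable
      aemeasurable_const).aestronglyMeasurable

theorem H0.exists_isAdmissible (h0 : P.H0) (hw : P.IsStrictControl w) :
    ∃ y, P.IsAdmissible w y := by
  obtain ⟨K, hG⟩ := h0.exists_isCaratheodoryField_dyn hw
  choose y hy₀ hy using fun ω => (hG ω).exists_hasW11Deriv P.time_lt.le (P.φ ω)
  exact ⟨fun t ω => y ω t, hw.isAdmissibleControl, fun ω => ⟨hy₀ ω, (hy ω).1⟩⟩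

theorem H0.aestronglyMeasurable_arc (h0 : P.H0) {μ : Measure Ω} [SFinite μ]
    (hφ : AEStronglyMeasurable P.φ μ) (hw : P.IsStrictControl w) {x : ℝ → Ω → StateSpace n}
    (hx : P.IsAdmissible w x) : ∀ t ∈ Icc P.t₀ P.T, AEStronglyMeasurable (x t) μ := by
  obtain ⟨K, hG⟩ := h0.exists_isCaratheodoryField_dyn hw
  refine aestronglyMeasurable_of_hasW11Deriv P.time_lt.le
    (hφ.congr (ae_of_all _ fun ω => (hx.2 ω).1.symm)) hG (fun y hy => ?_) fun ω => (hx.2 ω).2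
  exact (h0.aemeasurable_dyn hy.aemeasurable (hw.1.comp measurable_fst).aemeasurable
    measurable_snd.aemeasurable).aestronglyMeasurable

theorem H0.aestronglyMeasurable_uncurry_arc (h0 : P.H0) {μ : Measure Ω} [SFinite μ]
    (hφ : AEStronglyMeasurable P.φ μ) (hw : P.IsStrictControl w) {x : ℝ → Ω → StateSpace n}
    (hx : P.IsAdmissible w x) :
    AEStronglyMeasurable (fun z : ℝ × Ω => x z.1 z.2)
      ((volume.restrict (Icc P.t₀ P.T)).prod μ) :=
  aestronglyMeasurable_uncurry_of_continuousOn P.time_lt.le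
    (h0.aestronglyMeasurable_arc hφ hw hx) hx.continuousOn

end Measurability

namespace UniformBounds

variable {c K : NNReal}

theorem exists_arc_le (hb : P.UniformBounds c K) :
    ∃ M : NNReal, ∀ w x, P.IsStrictControl w → P.IsAdmissible w x →
      ∀ ω, ∀ t ∈ Icc P.t₀ P.T, 1 + ‖x t ω‖ ≤ M * (1 + ‖P.φ ω‖) := by
  obtain ⟨τ, hτ⟩ : ∃ τ : NNReal, (τ : ℝ) = P.T - P.t₀ := ⟨⟨_, sub_nonneg.2 P.time_lt.le⟩, rfl⟩
  refine ⟨(1 + c * τ) * (Real.exp (c * τ)).toNNReal, fun w x hw hx ω t ht => ?_⟩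
  have hx_le := (hx.2 ω).2.norm_le_mul_exp c.coe_nonneg c.coe_nonneg (ae_of_all _ fun s =>
    (hb.dyn_le _ (hw.2 s) (x s ω) ω).trans_eq (by ring)) t ht
  have hexp : 1 ≤ Real.exp (c * τ) := Real.one_le_exp (by positivity)
  rw [(hx.2 ω).1, ← hτ] at hx_le
  push_cast
  rw [Real.coe_toNNReal _ (Real.exp_nonneg _)]
  calc 1 + ‖x t ω‖ ≤ Real.exp (c * τ) + (‖P.φ ω‖ + c * τ) * Real.exp (c * τ) :=
        add_le_add hexp hx_le
    _ = (1 + c * τ + ‖P.φ ω‖) * Real.exp (c * τ) := by ring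
    _ ≤ ((1 + c * τ) * (1 + ‖P.φ ω‖)) * Real.exp (c * τ) := by
        gcongr
        nlinarith [(by positivity : 0 ≤ c * τ * ‖P.φ ω‖)]
    _ = (1 + c * τ) * Real.exp (c * τ) * (1 + ‖P.φ ω‖) := by ring

theorem norm_dyn_sub_le (hb : P.UniformBounds c K) {u u' : ℝ} (hu' : u' ∈ Icc P.umin P.umax)
    (x y : StateSpace n) (ω : Ω) :
    ‖P.dyn y u' ω - P.dyn x u ω‖ ≤ K * ‖y - x‖ + |u' - u| * (c * (1 + ‖x‖)) := by
  have hsplit : P.dyn y u' ω - P.dyn x u ω =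
      (P.dyn y u' ω - P.dyn x u' ω) + (u' - u) • P.f₁ x ω := by
    simp only [dyn, sub_smul]
    abel
  rw [hsplit]
  refine (norm_add_le _ _).trans (add_le_add ((hb.dyn_lip u' hu' ω).norm_sub_le y x) ?_)
  rw [norm_smul, Real.norm_eq_abs]
  exact mul_le_mul_of_nonneg_left (hb.f₁_le x ω) (abs_nonneg _)

theorem exists_stability (hb : P.UniformBounds c K) :
    ∃ C : NNReal, ∀ w w' x y ε, P.IsStrictControl w → P.IsStrictControl w' →
      (∀ t, |w' t - w t| ≤ ε) → P.IsAdmissible w x → P.IsAdmissible w' y →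
      ∀ ω, ∀ t ∈ Icc P.t₀ P.T, ‖y t ω - x t ω‖ ≤ C * ε * (1 + ‖P.φ ω‖) ∧
        ‖P.dyn (y t ω) (w' t) ω - P.dyn (x t ω) (w t) ω‖ ≤ C * ε * (1 + ‖P.φ ω‖) := by
  obtain ⟨M, hM⟩ := hb.exists_arc_le
  obtain ⟨τ, hτ⟩ : ∃ τ : NNReal, (τ : ℝ) = P.T - P.t₀ := ⟨⟨_, sub_nonneg.2 P.time_lt.le⟩, rfl⟩
  set A : NNReal := c * M * τ * (Real.exp (K * τ)).toNNReal with hA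
  refine ⟨A + (K * A + c * M), fun w w' x y ε hw hw' hww hx hy ω => ?_⟩
  set r := 1 + ‖P.φ ω‖
  have : 0 ≤ r := by positivity
  have hε : 0 ≤ ε := (abs_nonneg _).trans (hww P.t₀)
  have hvel : ∀ t ∈ Icc P.t₀ P.T, ‖P.dyn (y t ω) (w' t) ω - P.dyn (x t ω) (w t) ω‖ ≤
      K * ‖y t ω - x t ω‖ + ε * (c * (M * r)) := fun t ht =>
    (hb.norm_dyn_sub_le (hw'.2 t) _ _ ω).trans (by
      gcongr
      exacts [hww t, hM w x hw hx ω t ht])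
  have hstate : ∀ t ∈ Icc P.t₀ P.T, ‖y t ω - x t ω‖ ≤ A * ε * r := fun t ht => by
    have h := ((hy.2 ω).2.sub (hx.2 ω).2).norm_le_mul_exp K.coe_nonneg (c := ε * (c * (M * r)))
      (by positivity)
      (by filter_upwards [ae_restrict_mem measurableSet_Icc] with s hs using hvel s hs) t ht
    rw [(hx.2 ω).1, (hy.2 ω).1, sub_self, norm_zero, zero_add, ← hτ] at h
    refine h.trans_eq ?_
    rw [hA]
    push_cast
    rw [Real.coe_toNNReal _ (Real.exp_nonneg _)]
    ring
  intro t ht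
  have hKA : K * ‖y t ω - x t ω‖ ≤ K * (A * ε * r) :=
    mul_le_mul_of_nonneg_left (hstate t ht) K.2
  have : 0 ≤ (K * A + c * M) * ε * r := by positivity
  have : 0 ≤ A * ε * r := by positivity
  push_cast
  exact ⟨by linarith [hstate t ht], by linarith [hvel t ht]⟩

end UniformBounds

end AffineProblem

/-! ### Adjoint arcs -/

theorem inner_gradient_eq_fderiv {E : Type*} [NormedAddCommGroup E] [InnerProductSpace ℝ E]
    [CompleteSpace E] {f : E → ℝ} {y : E} (v : E) :
    inner ℝ v (gradient f y) = fderiv ℝ f y v := by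
  rw [real_inner_comm, gradient, InnerProductSpace.toDual_symm_apply]

theorem ae_prod_fst_mem_Icc {Ω : Type*} [MeasurableSpace Ω] {μ : Measure Ω} (a b : ℝ) :
    ∀ᵐ z ∂(volume.restrict (Icc a b)).prod μ, z.1 ∈ Icc a b :=
  Measure.quasiMeasurePreserving_fst.ae (ae_restrict_mem measurableSet_Icc)

namespace AffineProblem

variable {n : ℕ} {Ω : Type*} {P : AffineProblem n Ω}

section Jacobian

variable {c K : NNReal}

theorem hasFDerivAt_dyn {ω : Ω} {y : StateSpace n}
    (h₀ : DifferentiableAt ℝ (fun y => P.f₀ y ω) y)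
    (h₁ : DifferentiableAt ℝ (fun y => P.f₁ y ω) y) (u : ℝ) :
    HasFDerivAt (fun y => P.dyn y u ω)
      (fderiv ℝ (fun y => P.f₀ y ω) y + u • fderiv ℝ (fun y => P.f₁ y ω) y) y :=
  h₀.hasFDerivAt.add (h₁.hasFDerivAt.const_smul u)

theorem dynJac_eq {ω : Ω} {y : StateSpace n}
    (h₀ : DifferentiableAt ℝ (fun y => P.f₀ y ω) y)
    (h₁ : DifferentiableAt ℝ (fun y => P.f₁ y ω) y) (u : ℝ) :
    P.dynJac y u ω = fderiv ℝ (fun y => P.f₀ y ω) y + u • fderiv ℝ (fun y => P.f₁ y ω) y :=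
  (hasFDerivAt_dyn h₀ h₁ u).fderiv

theorem UniformBounds.norm_dynJac_le (hb : P.UniformBounds c K) {u : ℝ}
    (hu : u ∈ Icc P.umin P.umax) (y : StateSpace n) (ω : Ω) : ‖P.dynJac y u ω‖ ≤ K :=
  norm_fderiv_le_of_lipschitz ℝ (hb.dyn_lip u hu ω)

theorem UniformBounds.norm_adjoint_dynJac_le (hb : P.UniformBounds c K) {u : ℝ}
    (hu : u ∈ Icc P.umin P.umax) (y : StateSpace n) (ω : Ω) (q : StateSpace n) :
    ‖ContinuousLinearMap.adjoint (P.dynJac y u ω) q‖ ≤ K * ‖q‖ := by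
  refine ContinuousLinearMap.le_of_opNorm_le _ ?_ q
  rw [LinearIsometryEquiv.norm_map]
  exact hb.norm_dynJac_le hu y ω

variable [MeasurableSpace Ω]

theorem H0.aemeasurable_adjoint_dynJac (h0 : P.H0) {α : Type*} [MeasurableSpace α]
    {ν : Measure α} {y q : α → StateSpace n} {s : α → ℝ} {ω : α → Ω}
    (hy : AEMeasurable y ν) (hq : AEMeasurable q ν) (hs : AEMeasurable s ν)
    (hω : AEMeasurable ω ν)
    (hd₀ : ∀ᵐ i ∂ν, DifferentiableAt ℝ (fun z => P.f₀ z (ω i)) (y i))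
    (hd₁ : ∀ᵐ i ∂ν, DifferentiableAt ℝ (fun z => P.f₁ z (ω i)) (y i)) :
    AEMeasurable (fun i => ContinuousLinearMap.adjoint (P.dynJac (y i) (s i) (ω i)) (q i)) ν := by
  refine aemeasurable_of_forall_inner fun v => ?_
  have h₀ := aemeasurable_fderiv_apply h0.measurable_f₀ hy (aemeasurable_const (b := v)) hω hd₀
  have h₁ := aemeasurable_fderiv_apply h0.measurable_f₁ hy (aemeasurable_const (b := v)) hω hd₁
  refine ((h₀.add (hs.smul h₁)).inner hq (𝕜 := ℝ)).congr ?_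
  filter_upwards [hd₀, hd₁] with i hi₀ hi₁
  rw [ContinuousLinearMap.adjoint_inner_right, dynJac_eq hi₀ hi₁]
  rfl

end Jacobian

section Costate

variable [MeasurableSpace Ω] {μ : Measure Ω} {w : ℝ → ℝ} {x q : ℝ → Ω → StateSpace n} {B : ℝ}

/-- The smoothness of the data along a family of arcs that the characterization of the control
rests on: it follows from `H1`, and involves the arcs only, not a tube around them. -/
structure IsSmoothAlong (P : AffineProblem n Ω) (μ : Measure Ω) (x : ℝ → Ω → StateSpace n) :
    Prop where
  smooth₀ : ∀ ω, ∀ t ∈ Icc P.t₀ P.T, ContDiffAt ℝ 2 (fun y => P.f₀ y ω) (x t ω)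
  smooth₁ : ∀ ω, ∀ t ∈ Icc P.t₀ P.T, ContDiffAt ℝ 2 (fun y => P.f₁ y ω) (x t ω)
  bound_snd : ∃ C : ℝ, ∀ᵐ ω ∂μ, ∀ t ∈ Icc P.t₀ P.T,
    ‖fderiv ℝ (fderiv ℝ fun y => P.f₀ y ω) (x t ω)‖ ≤ C ∧
    ‖fderiv ℝ (fderiv ℝ fun y => P.f₁ y ω) (x t ω)‖ ≤ C
  diff_g : ∀ ω, DifferentiableAt ℝ (fun y => P.g y ω) (x P.T ω)

/-- An admissible process with a strict control along which the data are smooth. -/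
structure IsRegular (P : AffineProblem n Ω) (μ : Measure Ω) (w : ℝ → ℝ)
    (x : ℝ → Ω → StateSpace n) : Prop extends P.IsSmoothAlong μ x where
  control : P.IsStrictControl w
  adm : P.IsAdmissible w x

/-- The family of adjoint arcs `q(·,ω)` of a process, for every parameter `ω`, measurable in `ω`
and bounded by `B`. -/
structure IsBoundedCostate (P : AffineProblem n Ω) (μ : Measure Ω) (w : ℝ → ℝ)
    (x q : ℝ → Ω → StateSpace n) (B : ℝ) : Prop where
  adjoint : ∀ ω, HasW11Deriv P.t₀ P.T (fun t => q t ω)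
    (fun t => -ContinuousLinearMap.adjoint (P.dynJac (x t ω) (w t) ω) (q t ω))
  terminal : ∀ ω, -q P.T ω = gradient (fun y => P.g y ω) (x P.T ω)
  bound : ∀ ω, ∀ t ∈ Icc P.t₀ P.T, ‖q t ω‖ ≤ B
  meas : ∀ t ∈ Icc P.t₀ P.T, AEStronglyMeasurable (q t) μ

theorem IsSmoothAlong.differentiableAt_f₀ (h : P.IsSmoothAlong μ x) (ω : Ω) {t : ℝ}
    (ht : t ∈ Icc P.t₀ P.T) : DifferentiableAt ℝ (fun y => P.f₀ y ω) (x t ω) :=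
  (h.smooth₀ ω t ht).differentiableAt two_ne_zero

theorem IsSmoothAlong.differentiableAt_f₁ (h : P.IsSmoothAlong μ x) (ω : Ω) {t : ℝ}
    (ht : t ∈ Icc P.t₀ P.T) : DifferentiableAt ℝ (fun y => P.f₁ y ω) (x t ω) :=
  (h.smooth₁ ω t ht).differentiableAt two_ne_zero

theorem H0.exists_isCaratheodoryField_adjoint (h0 : P.H0) (hr : P.IsRegular μ w x) :
    ∃ K, ∀ ω, IsCaratheodoryField P.t₀ P.T K fun s y =>
      -ContinuousLinearMap.adjoint (P.dynJac (x s ω) (w s) ω) y := by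
  obtain ⟨c, K, hb⟩ := h0.exists_uniformBounds
  refine ⟨K, fun ω => .of_norm_zero_le P.time_lt.le (fun s _ => ?_) (C := 0) (fun s _ => ?_)
    fun y hy => ?_⟩
  · refine .of_dist_le_mul fun y z => ?_
    rw [dist_neg_neg, dist_eq_norm, dist_eq_norm, ← map_sub]
    exact hb.norm_adjoint_dynJac_le (hr.control.2 s) _ _ _
  · rw [map_zero, neg_zero, norm_zero]
  · refine (h0.aemeasurable_adjoint_dynJac ((hr.adm.continuousOn ω).aemeasurable
      measurableSet_Icc) (hy.aemeasurable measurableSet_Icc) hr.control.1.aemeasurable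
      aemeasurable_const ?_ ?_).neg.aestronglyMeasurable
    all_goals filter_upwards [ae_restrict_mem measurableSet_Icc] with s hs
    exacts [hr.differentiableAt_f₀ ω hs, hr.differentiableAt_f₁ ω hs]

variable [SFinite μ]

theorem H0.aestronglyMeasurable_adjoint (h0 : P.H0) (hφ : AEStronglyMeasurable P.φ μ)
    (hr : P.IsRegular μ w x)
    (hq : AEStronglyMeasurable (fun z : ℝ × Ω => q z.1 z.2)
      ((volume.restrict (Icc P.t₀ P.T)).prod μ)) :
    AEStronglyMeasurable (fun z : ℝ × Ω =>
        -ContinuousLinearMap.adjoint (P.dynJac (x z.1 z.2) (w z.1) z.2) (q z.1 z.2))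
      ((volume.restrict (Icc P.t₀ P.T)).prod μ) := by
  refine (h0.aemeasurable_adjoint_dynJac
    (h0.aestronglyMeasurable_uncurry_arc hφ hr.control hr.adm).aemeasurable hq.aemeasurable
    (hr.control.1.comp measurable_fst).aemeasurable measurable_snd.aemeasurable
    ?_ ?_).neg.aestronglyMeasurable
  all_goals filter_upwards [ae_prod_fst_mem_Icc P.t₀ P.T] with z hz
  exacts [hr.differentiableAt_f₀ z.2 hz, hr.differentiableAt_f₁ z.2 hz]

theorem H0.aestronglyMeasurable_gradient (h0 : P.H0) (hφ : AEStronglyMeasurable P.φ μ)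
    (hr : P.IsRegular μ w x) :
    AEStronglyMeasurable (fun ω => gradient (fun y => P.g y ω) (x P.T ω)) μ := by
  have hxT := h0.aestronglyMeasurable_arc hφ hr.control hr.adm P.T (right_mem_Icc.2 P.time_lt.le)
  refine (aemeasurable_of_forall_inner fun v => ?_).aestronglyMeasurable
  simp only [inner_gradient_eq_fderiv]
  exact aemeasurable_fderiv_apply h0.meas_g hxT.aemeasurable aemeasurable_const aemeasurable_id
    (ae_of_all _ hr.diff_g)

theorem H0.exists_norm_gradient_le (h0 : P.H0) :
    ∃ k : NNReal, ∀ y ω, ‖gradient (fun z => P.g z ω) y‖ ≤ k := by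
  obtain ⟨k, hk, hlip⟩ := h0.lip_g
  lift k to NNReal using zero_le_one.trans hk
  refine ⟨k, fun y ω => ?_⟩
  rw [gradient, LinearIsometryEquiv.norm_map]
  exact norm_fderiv_le_of_lipschitz ℝ (.of_dist_le_mul fun y z => by
    simpa only [dist_eq_norm, Real.norm_eq_abs] using hlip y z ω)

theorem H0.exists_isBoundedCostate (h0 : P.H0) (hφ : AEStronglyMeasurable P.φ μ)
    (hr : P.IsRegular μ w x) : ∃ q B, P.IsBoundedCostate μ w x q B := by
  have hab : P.t₀ ≤ P.T := P.time_lt.le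
  obtain ⟨c, L, hb⟩ := h0.exists_uniformBounds
  obtain ⟨k, hk⟩ := h0.exists_norm_gradient_le
  obtain ⟨K, hG⟩ := h0.exists_isCaratheodoryField_adjoint hr
  choose y hyT hy using fun ω =>
    (hG ω).exists_hasW11Deriv_right hab (-gradient (fun z => P.g z ω) (x P.T ω))
  refine ⟨fun t ω => y ω t, k * Real.exp (L * (P.T - P.t₀)), hy, fun ω => ?_, fun ω t ht => ?_,
    aestronglyMeasurable_of_hasW11Deriv_right hab ?_ hG
      (fun z hz => h0.aestronglyMeasurable_adjoint hφ hr hz) hy⟩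
  · rw [hyT, neg_neg]
  · have hσt : P.t₀ + P.T - t ∈ Icc P.t₀ P.T := ⟨by linarith [ht.2], by linarith [ht.1]⟩
    have h := ((hy ω).reverse hab).norm_le_mul_exp L.coe_nonneg le_rfl (ae_of_all _ fun s => by
      simpa using hb.norm_adjoint_dynJac_le (hr.control.2 _) _ ω _) _ hσt
    rw [zero_mul, add_zero, sub_sub_cancel, add_sub_cancel_left, hyT, norm_neg] at h
    exact h.trans (by gcongr; exact hk _ ω)
  · simp only [hyT]
    exact (h0.aestronglyMeasurable_gradient hφ hr).neg

end Costate

theorem IsBoundedCostate.continuousOn [MeasurableSpace Ω] {μ : Measure Ω} {w : ℝ → ℝ}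
    {x q : ℝ → Ω → StateSpace n} {B : ℝ} (hq : P.IsBoundedCostate μ w x q B) (ω : Ω) :
    ContinuousOn (fun t => q t ω) (Icc P.t₀ P.T) :=
  (hq.adjoint ω).continuousOn

theorem IsBoundedCostate.aestronglyMeasurable_uncurry [MeasurableSpace Ω] {μ : Measure Ω}
    {w : ℝ → ℝ} {x q : ℝ → Ω → StateSpace n} {B : ℝ}
    (hq : P.IsBoundedCostate μ w x q B) :
    AEStronglyMeasurable (fun z : ℝ × Ω => q z.1 z.2)
      ((volume.restrict (Icc P.t₀ P.T)).prod μ) :=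
  aestronglyMeasurable_uncurry_of_continuousOn P.time_lt.le hq.meas hq.continuousOn

end AffineProblem

/-! ### Averages along the arcs and the singular equation -/

namespace HasW11Deriv

variable {E Y : Type*} [NormedAddCommGroup E] [NormedAddCommGroup Y] [NormedSpace ℝ Y] {a b : ℝ}

theorem inner_comp [InnerProductSpace ℝ E] [CompleteSpace E] [CompleteSpace Y] {p p' : ℝ → E}
    {y y' : ℝ → Y} {h : Y → E} {C C' : ℝ} (hp : HasW11Deriv a b p p') (hy : HasW11Deriv a b y y')
    (hab : a ≤ b) (hp' : ∀ t ∈ Icc a b, ‖p' t‖ ≤ C) (hy' : ∀ t ∈ Icc a b, ‖y' t‖ ≤ C')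
    (hh : ∀ t ∈ Icc a b, ContDiffAt ℝ 1 h (y t)) :
    HasW11Deriv a b (fun t => inner ℝ (p t) (h (y t)))
      (fun t => inner ℝ (p t) (fderiv ℝ h (y t) (y' t)) + inner ℝ (p' t) (h (y t))) := by
  have hsmooth : ∀ t ∈ Icc a b, ContDiffAt ℝ 1 (fun z : E × Y => h z.2) (p t, y t) :=
    fun t ht => ContDiffAt.comp (p t, y t) (hh t ht) contDiff_snd.contDiffAt
  have hpair := (hp.prodMk hy).fderiv_comp hab (C := max C C')
    (F := fun z : E × Y => inner ℝ z.1 (h z.2))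
    (fun t ht => max_le_max (hp' t ht) (hy' t ht))
    (fun t ht => contDiff_fst.contDiffAt.inner ℝ (hsmooth t ht))
  refine hpair.congr_ae hab ?_
  filter_upwards [ae_restrict_mem measurableSet_Icc] with t ht
  have hderiv : HasFDerivAt (fun z : E × Y => h z.2)
      ((fderiv ℝ h (y t)).comp (ContinuousLinearMap.snd ℝ E Y)) (p t, y t) :=
    HasFDerivAt.comp (p t, y t) ((hh t ht).differentiableAt one_ne_zero).hasFDerivAt
      hasFDerivAt_snd
  rw [(hasFDerivAt_fst.inner ℝ hderiv).fderiv]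
  simp [fderivInnerCLM_apply]

theorem ae_eq_zero_of_eqOn_zero [CompleteSpace Y] {a' b' : ℝ} {z v : ℝ → Y}
    (h : HasW11Deriv a b z v)
    (hsub : Ioo a' b' ⊆ Icc a b) (hz : ∀ t ∈ Ioo a' b', z t = 0) :
    ∀ᵐ t ∂volume.restrict (Ioo a' b'), v t = 0 := by
  have hsub' : Ioo a' b' ⊆ Ioo a b :=
    (interior_maximal hsub isOpen_Ioo).trans interior_Icc.subset
  rw [ae_restrict_iff' measurableSet_Ioo]
  filter_upwards [h.ae_hasDerivAt] with t ht htab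
  refine (ht (hsub' htab)).unique ((hasDerivAt_const t (0 : Y)).congr_of_eventuallyEq ?_)
  filter_upwards [Ioo_mem_nhds htab.1 htab.2] with s hs using hz s hs

theorem integral {Ω : Type*} [MeasurableSpace Ω] {μ : Measure Ω} [SFinite μ] {z v : ℝ → Ω → Y}
    (hz : ∀ ω, HasW11Deriv a b (fun t => z t ω) (fun t => v t ω)) (hab : a ≤ b)
    (hza : Integrable (z a) μ)
    (hv : Integrable (fun p : ℝ × Ω => v p.1 p.2) ((volume.restrict (Icc a b)).prod μ)) :
    HasW11Deriv a b (fun t => ∫ ω, z t ω ∂μ) (fun t => ∫ ω, v t ω ∂μ) := by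
  refine ⟨(intervalIntegrable_iff_integrableOn_Icc_of_le hab).2 hv.integral_prod_left,
    fun t ht => ?_⟩
  have hv' : Integrable (fun p : ℝ × Ω => v p.1 p.2) ((volume.restrict (Ioc a t)).prod μ) :=
    hv.mono_measure (Measure.prod_mono (Measure.restrict_mono
      (Ioc_subset_Icc_self.trans (Icc_subset_Icc_right ht.2)) le_rfl) le_rfl)
  calc ∫ ω, z t ω ∂μ = ∫ ω, (z a ω + ∫ s in Ioc a t, v s ω) ∂μ := by
        refine integral_congr_ae (ae_of_all _ fun ω => ?_)
        simpa only [intervalIntegral.integral_of_le ht.1] using (hz ω).2 t ht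
    _ = ∫ ω, z a ω ∂μ + ∫ ω, (∫ s in Ioc a t, v s ω) ∂μ := integral_add hza hv'.integral_prod_right
    _ = ∫ ω, z a ω ∂μ + ∫ s in a..t, (∫ ω, v s ω ∂μ) := by
        rw [← integral_integral_swap hv', intervalIntegral.integral_of_le ht.1]

end HasW11Deriv

section BracketBound

variable {E : Type*} [NormedAddCommGroup E] [NormedSpace ℝ E] {U V W : E → E} {y : E}

theorem norm_lieBracket_le : ‖VectorField.lieBracket ℝ V W y‖ ≤
    ‖fderiv ℝ W y‖ * ‖V y‖ + ‖fderiv ℝ V y‖ * ‖W y‖ :=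
  (norm_sub_le _ _).trans (add_le_add (ContinuousLinearMap.le_opNorm _ _)
    (ContinuousLinearMap.le_opNorm _ _))

theorem norm_fderiv_lieBracket_le (hV : ContDiffAt ℝ 2 V y) (hW : ContDiffAt ℝ 2 W y) :
    ‖fderiv ℝ (VectorField.lieBracket ℝ V W) y‖ ≤ 2 * (‖fderiv ℝ V y‖ * ‖fderiv ℝ W y‖) +
      (‖fderiv ℝ (fderiv ℝ W) y‖ * ‖V y‖ + ‖fderiv ℝ (fderiv ℝ V) y‖ * ‖W y‖) := by
  have dV := (hV.differentiableAt two_ne_zero).hasFDerivAt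
  have dW := (hW.differentiableAt two_ne_zero).hasFDerivAt
  have ddV := ((hV.fderiv_right (m := 1) (by norm_num)).differentiableAt one_ne_zero).hasFDerivAt
  have ddW := ((hW.fderiv_right (m := 1) (by norm_num)).differentiableAt one_ne_zero).hasFDerivAt
  have hbracket : HasFDerivAt (VectorField.lieBracket ℝ V W) _ y :=
    (ddW.clm_apply dV).sub (ddV.clm_apply dW)
  have hflip {A : E →L[ℝ] E →L[ℝ] E} (v : E) : ‖A.flip v‖ ≤ ‖A‖ * ‖v‖ :=
    (A.flip.le_opNorm v).trans_eq (by rw [ContinuousLinearMap.opNorm_flip])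
  rw [hbracket.fderiv]
  refine (norm_sub_le _ _).trans ((add_le_add
    (norm_add_le_of_le (ContinuousLinearMap.opNorm_comp_le _ _) (hflip _))
    (norm_add_le_of_le (ContinuousLinearMap.opNorm_comp_le _ _) (hflip _))).trans_eq ?_)
  ring

theorem norm_lieBracket_lieBracket_le {K R C : ℝ} (hVs : ContDiffAt ℝ 2 V y)
    (hWs : ContDiffAt ℝ 2 W y) (hU : ‖U y‖ ≤ R) (hV : ‖V y‖ ≤ R) (hW : ‖W y‖ ≤ R)
    (hU' : ‖fderiv ℝ U y‖ ≤ K) (hV' : ‖fderiv ℝ V y‖ ≤ K) (hW' : ‖fderiv ℝ W y‖ ≤ K)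
    (hV'' : ‖fderiv ℝ (fderiv ℝ V) y‖ ≤ C) (hW'' : ‖fderiv ℝ (fderiv ℝ W) y‖ ≤ C) :
    ‖VectorField.lieBracket ℝ U (VectorField.lieBracket ℝ V W) y‖ ≤
      4 * K ^ 2 * R + 2 * C * R ^ 2 := by
  have hR : 0 ≤ R := (norm_nonneg _).trans hU
  have hK : 0 ≤ K := (norm_nonneg _).trans hU'
  have hC : 0 ≤ C := (norm_nonneg _).trans hV''
  have hVW : ‖VectorField.lieBracket ℝ V W y‖ ≤ K * R + K * R :=
    norm_lieBracket_le.trans (by gcongr)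
  have hVW' : ‖fderiv ℝ (VectorField.lieBracket ℝ V W) y‖ ≤ 2 * (K * K) + (C * R + C * R) :=
    (norm_fderiv_lieBracket_le hVs hWs).trans (by gcongr)
  calc _ ≤ (2 * (K * K) + (C * R + C * R)) * R + K * (K * R + K * R) :=
        norm_lieBracket_le.trans (by gcongr)
    _ = 4 * K ^ 2 * R + 2 * C * R ^ 2 := by ring

end BracketBound

namespace AffineProblem

variable {n : ℕ} {Ω : Type*} {P : AffineProblem n Ω}

/-- The Lie bracket, in the state variable, of two parametrized vector fields. -/
noncomputable def bracket (V W : StateSpace n → Ω → StateSpace n) (y : StateSpace n) (ω : Ω) :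
    StateSpace n :=
  VectorField.lieBracket ℝ (fun z => V z ω) (fun z => W z ω) y

variable [MeasurableSpace Ω] {μ : Measure Ω} {w : ℝ → ℝ} {x q : ℝ → Ω → StateSpace n} {B : ℝ}
  {h : StateSpace n → Ω → StateSpace n}

/-- The average over `ω` of the pairing of a parametrized vector field along the arcs `x` with the
adjoint arcs `q`; the switching function is the case of the field `f₁`. -/
noncomputable def avgPairing (μ : Measure Ω) (x q : ℝ → Ω → StateSpace n)
    (h : StateSpace n → Ω → StateSpace n) (t : ℝ) : ℝ :=
  ∫ ω, inner ℝ (q t ω) (h (x t ω) ω) ∂μ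

/-- A parametrized vector field that has quadratic growth in the initial state along the arcs, so
that its pairing with bounded adjoint arcs is integrable when `φ ∈ L²`. Brackets are not measurable
off the set where the fields are smooth; hence the field is only asked to coincide with a measurable
one along the arcs. -/
structure IsTame (P : AffineProblem n Ω) (μ : Measure Ω) (x : ℝ → Ω → StateSpace n)
    (h : StateSpace n → Ω → StateSpace n) : Prop where
  bound : ∃ C : ℝ, ∀ᵐ ω ∂μ, ∀ t ∈ Icc P.t₀ P.T, ‖h (x t ω) ω‖ ≤ C * (1 + ‖P.φ ω‖) ^ 2
  meas : ∃ k : StateSpace n → Ω → StateSpace n,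
    (Measurable fun z : StateSpace n × Ω => k z.1 z.2) ∧
      ∀ ω, ∀ t ∈ Icc P.t₀ P.T, h (x t ω) ω = k (x t ω) ω

theorem IsTame.of_norm_le {R : NNReal}
    (hR : ∀ ω, ∀ t ∈ Icc P.t₀ P.T, ‖h (x t ω) ω‖ ≤ R * (1 + ‖P.φ ω‖))
    {k : StateSpace n → Ω → StateSpace n} (hk : Measurable fun z : StateSpace n × Ω => k z.1 z.2)
    (hhk : ∀ ω, ∀ t ∈ Icc P.t₀ P.T, h (x t ω) ω = k (x t ω) ω) : P.IsTame μ x h := by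
  refine ⟨⟨R, ae_of_all _ fun ω t ht => (hR ω t ht).trans ?_⟩, k, hk, hhk⟩
  gcongr
  exact le_self_pow₀ (le_add_of_nonneg_right (norm_nonneg _)) two_ne_zero

theorem isTame_bracket_self : P.IsTame μ x (bracket h h) :=
  .of_norm_le (R := 0) (k := fun _ _ => 0) (by simp [bracket]) measurable_const
    (by simp [bracket])

theorem integrable_one_add_norm_sq [IsFiniteMeasure μ] (hφ : MemLp P.φ 2 μ) :
    Integrable (fun ω => (1 + ‖P.φ ω‖) ^ 2) μ :=
  ((memLp_const (1 : ℝ)).add hφ.norm).integrable_sq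

theorem IsBoundedCostate.norm_inner_le (hq : P.IsBoundedCostate μ w x q B) {ω : Ω} {t : ℝ}
    (ht : t ∈ Icc P.t₀ P.T) {v : StateSpace n} {R : ℝ} (hv : ‖v‖ ≤ R) :
    ‖inner ℝ (q t ω) v‖ ≤ B * R :=
  (norm_inner_le_norm _ _).trans (mul_le_mul (hq.bound ω t ht) hv (norm_nonneg _)
    ((norm_nonneg _).trans (hq.bound ω t ht)))

theorem IsTame.integrable [IsFiniteMeasure μ] (hh : P.IsTame μ x h) (h0 : P.H0)
    (hφ : MemLp P.φ 2 μ) (hr : P.IsRegular μ w x) (hq : P.IsBoundedCostate μ w x q B) {t : ℝ}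
    (ht : t ∈ Icc P.t₀ P.T) : Integrable (fun ω => inner ℝ (q t ω) (h (x t ω) ω)) μ := by
  obtain ⟨C, hC⟩ := hh.bound
  obtain ⟨k, hk, hhk⟩ := hh.meas
  refine (((integrable_one_add_norm_sq hφ).const_mul C).const_mul B).mono' ?_ ?_
  · have hx := h0.aestronglyMeasurable_arc hφ.aestronglyMeasurable hr.control hr.adm t ht
    simp only [hhk _ t ht]
    exact (hq.meas t ht).inner (hk.comp_aemeasurable
      (hx.aemeasurable.prodMk aemeasurable_id)).aestronglyMeasurable
  · filter_upwards [hC] with ω hω using hq.norm_inner_le ht (hω t ht)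

theorem IsTame.integrable_prod [IsFiniteMeasure μ] (hh : P.IsTame μ x h) (h0 : P.H0)
    (hφ : MemLp P.φ 2 μ) (hr : P.IsRegular μ w x) (hq : P.IsBoundedCostate μ w x q B) :
    Integrable (fun z : ℝ × Ω => inner ℝ (q z.1 z.2) (h (x z.1 z.2) z.2))
      ((volume.restrict (Icc P.t₀ P.T)).prod μ) := by
  obtain ⟨C, hC⟩ := hh.bound
  obtain ⟨k, hk, hhk⟩ := hh.meas
  have hmem := ae_prod_fst_mem_Icc (μ := μ) P.t₀ P.T
  refine ((((integrable_one_add_norm_sq hφ).const_mul C).const_mul B).comp_snd _).mono' ?_ ?_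
  · have hx := h0.aestronglyMeasurable_uncurry_arc hφ.aestronglyMeasurable hr.control hr.adm
    refine (hq.aestronglyMeasurable_uncurry.inner (𝕜 := ℝ) (hk.comp_aemeasurable
      (hx.aemeasurable.prodMk measurable_snd.aemeasurable)).aestronglyMeasurable).congr ?_
    filter_upwards [hmem] with z hz
    rw [hhk z.2 z.1 hz]
    rfl
  · filter_upwards [hmem, Measure.quasiMeasurePreserving_snd.ae hC] with z hz hb using
      hq.norm_inner_le hz (hb z.1 hz)

theorem hasW11Deriv_inner_field (h0 : P.H0) (hr : P.IsRegular μ w x)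
    (hq : P.IsBoundedCostate μ w x q B) {ω : Ω}
    (hs : ∀ t ∈ Icc P.t₀ P.T, ContDiffAt ℝ 1 (fun y => h y ω) (x t ω)) :
    HasW11Deriv P.t₀ P.T (fun t => inner ℝ (q t ω) (h (x t ω) ω))
      (fun t => inner ℝ (q t ω) (bracket P.f₀ h (x t ω) ω) +
        w t * inner ℝ (q t ω) (bracket P.f₁ h (x t ω) ω)) := by
  obtain ⟨c, K, hb⟩ := h0.exists_uniformBounds
  obtain ⟨M, hM⟩ := hb.exists_arc_le
  have hadj : ∀ t ∈ Icc P.t₀ P.T,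
      ‖-ContinuousLinearMap.adjoint (P.dynJac (x t ω) (w t) ω) (q t ω)‖ ≤ K * B := fun t ht => by
    rw [norm_neg]
    exact (hb.norm_adjoint_dynJac_le (hr.control.2 t) _ _ _).trans
      (mul_le_mul_of_nonneg_left (hq.bound ω t ht) K.coe_nonneg)
  have hdyn : ∀ t ∈ Icc P.t₀ P.T, ‖P.dyn (x t ω) (w t) ω‖ ≤ c * (M * (1 + ‖P.φ ω‖)) :=
    fun t ht => (hb.dyn_le _ (hr.control.2 t) _ _).trans
      (mul_le_mul_of_nonneg_left (hM w x hr.control hr.adm ω t ht) c.coe_nonneg)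
  refine ((hq.adjoint ω).inner_comp (h := fun y => h y ω) (hr.adm.2 ω).2 P.time_lt.le hadj hdyn
    hs).congr_ae P.time_lt.le ?_
  filter_upwards [ae_restrict_mem measurableSet_Icc] with t ht
  rw [inner_neg_left, ContinuousLinearMap.adjoint_inner_left,
    dynJac_eq (hr.differentiableAt_f₀ ω ht) (hr.differentiableAt_f₁ ω ht)]
  simp only [bracket, VectorField.lieBracket, dyn, map_add, map_smul, inner_add_right,
    inner_sub_right, inner_smul_right, add_apply, smul_apply]
  ring

theorem hasW11Deriv_avgPairing [IsFiniteMeasure μ] (h0 : P.H0) (hφ : MemLp P.φ 2 μ)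
    (hr : P.IsRegular μ w x) (hq : P.IsBoundedCostate μ w x q B)
    (hs : ∀ ω, ∀ t ∈ Icc P.t₀ P.T, ContDiffAt ℝ 1 (fun y => h y ω) (x t ω))
    (hh : P.IsTame μ x h) (hh₀ : P.IsTame μ x (bracket P.f₀ h))
    (hh₁ : P.IsTame μ x (bracket P.f₁ h)) :
    HasW11Deriv P.t₀ P.T (avgPairing μ x q h)
      fun t => avgPairing μ x q (bracket P.f₀ h) t + w t * avgPairing μ x q (bracket P.f₁ h) t := by
  have hab := P.time_lt.le
  have hint := (hh₀.integrable_prod h0 hφ hr hq).add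
    ((hh₁.integrable_prod h0 hφ hr hq).bdd_mul (c := max |P.umin| |P.umax|)
      (hr.control.1.comp measurable_fst).aestronglyMeasurable (ae_of_all _ fun z =>
        abs_le_max_abs_abs (hr.control.2 z.1).1 (hr.control.2 z.1).2))
  refine (HasW11Deriv.integral (fun ω => hasW11Deriv_inner_field h0 hr hq (hs ω)) hab
    (hh.integrable h0 hφ hr hq (left_mem_Icc.2 hab)) hint).congr_ae hab ?_
  filter_upwards [ae_restrict_mem measurableSet_Icc] with t ht
  rw [integral_add (hh₀.integrable h0 hφ hr hq ht)
    ((hh₁.integrable h0 hφ hr hq ht).const_mul _), integral_const_mul]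
  rfl

namespace IsRegular

theorem contDiffAt_bracket (hr : P.IsRegular μ w x) (ω : Ω) {t : ℝ} (ht : t ∈ Icc P.t₀ P.T) :
    ContDiffAt ℝ 1 (fun y => bracket P.f₀ P.f₁ y ω) (x t ω) :=
  (hr.smooth₀ ω t ht).lieBracket_vectorField (hr.smooth₁ ω t ht) (by norm_num)

theorem bracketLim_eventuallyEq (hr : P.IsRegular μ w x) (ω : Ω) {t : ℝ}
    (ht : t ∈ Icc P.t₀ P.T) :
    (fun y => bracketLim P.f₀ P.f₁ y ω) =ᶠ[𝓝 (x t ω)] fun y => bracket P.f₀ P.f₁ y ω := by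
  filter_upwards [(hr.smooth₀ ω t ht).eventually (by simp),
    (hr.smooth₁ ω t ht).eventually (by simp)] with y h₀ h₁
  exact bracketLim_eq_lieBracket (h₀.differentiableAt two_ne_zero)
    (h₁.differentiableAt two_ne_zero)

theorem bracketLim_bracketLim_eq (hr : P.IsRegular μ w x) (ω : Ω) {t : ℝ}
    (ht : t ∈ Icc P.t₀ P.T) (hh : DifferentiableAt ℝ (fun y => h y ω) (x t ω)) :
    bracketLim h (bracketLim P.f₀ P.f₁) (x t ω) ω =
      bracket h (bracket P.f₀ P.f₁) (x t ω) ω := by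
  have heq := hr.bracketLim_eventuallyEq ω ht
  rw [bracketLim_eq_lieBracket hh (((hr.contDiffAt_bracket ω ht).differentiableAt
    one_ne_zero).congr_of_eventuallyEq heq)]
  exact EventuallyEq.rfl.lieBracket_vectorField_eq heq

theorem exists_norm_le_along {c K : NNReal} (hr : P.IsRegular μ w x) (hb : P.UniformBounds c K) :
    ∃ R : NNReal, ∀ h : StateSpace n → Ω → StateSpace n, (∀ y ω, ‖h y ω‖ ≤ c * (1 + ‖y‖)) →
      ∀ ω, ∀ t ∈ Icc P.t₀ P.T, ‖h (x t ω) ω‖ ≤ R * (1 + ‖P.φ ω‖) := by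
  obtain ⟨M, hM⟩ := hb.exists_arc_le
  refine ⟨c * M, fun h hh ω t ht => (hh _ ω).trans ?_⟩
  rw [NNReal.coe_mul, mul_assoc]
  exact mul_le_mul_of_nonneg_left (hM w x hr.control hr.adm ω t ht) c.coe_nonneg

theorem isTame_f₁ (hr : P.IsRegular μ w x) (h0 : P.H0) : P.IsTame μ x P.f₁ := by
  obtain ⟨c, K, hb⟩ := h0.exists_uniformBounds
  obtain ⟨R, hR⟩ := hr.exists_norm_le_along hb
  exact IsTame.of_norm_le (hR P.f₁ hb.f₁_le) h0.measurable_f₁ fun _ _ _ => rfl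

theorem isTame_bracket (hr : P.IsRegular μ w x) (h0 : P.H0) :
    P.IsTame μ x (bracket P.f₀ P.f₁) := by
  obtain ⟨c, K, hb⟩ := h0.exists_uniformBounds
  obtain ⟨R, hR⟩ := hr.exists_norm_le_along hb
  refine IsTame.of_norm_le (R := 2 * K * R) (fun ω t ht => ?_)
    (measurable_bracketLim h0.measurable_f₀ h0.measurable_f₁)
    fun ω t ht => (hr.bracketLim_eventuallyEq ω ht).eq_of_nhds.symm
  calc ‖bracket P.f₀ P.f₁ (x t ω) ω‖ ≤ K * (R * (1 + ‖P.φ ω‖)) + K * (R * (1 + ‖P.φ ω‖)) := by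
        refine norm_lieBracket_le.trans ?_
        gcongr
        exacts [norm_fderiv_le_of_lipschitz ℝ (hb.f₁_lip ω), hR P.f₀ hb.f₀_le ω t ht,
          norm_fderiv_le_of_lipschitz ℝ (hb.f₀_lip ω), hR P.f₁ hb.f₁_le ω t ht]
    _ = ↑(2 * K * R) * (1 + ‖P.φ ω‖) := by push_cast; ring

theorem isTame_bracket_bracket {c K : NNReal} (hr : P.IsRegular μ w x) (h0 : P.H0)
    (hb : P.UniformBounds c K) (hc : ∀ y ω, ‖h y ω‖ ≤ c * (1 + ‖y‖))
    (hK : ∀ ω, LipschitzWith K fun y => h y ω)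
    (hd : ∀ ω, ∀ t ∈ Icc P.t₀ P.T, DifferentiableAt ℝ (fun y => h y ω) (x t ω))
    (hm : Measurable fun z : StateSpace n × Ω => h z.1 z.2) :
    P.IsTame μ x (bracket h (bracket P.f₀ P.f₁)) := by
  obtain ⟨R, hR⟩ := hr.exists_norm_le_along hb
  obtain ⟨C, hC⟩ := hr.bound_snd
  refine ⟨⟨4 * K ^ 2 * R + 2 * C * R ^ 2, ?_⟩, _,
    measurable_bracketLim hm (measurable_bracketLim h0.measurable_f₀ h0.measurable_f₁),
    fun ω t ht => (hr.bracketLim_bracketLim_eq ω ht (hd ω t ht)).symm⟩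
  filter_upwards [hC] with ω hω t ht
  have hlin : 1 + ‖P.φ ω‖ ≤ (1 + ‖P.φ ω‖) ^ 2 :=
    le_self_pow₀ (le_add_of_nonneg_right (norm_nonneg _)) two_ne_zero
  calc ‖bracket h (bracket P.f₀ P.f₁) (x t ω) ω‖ ≤
        4 * K ^ 2 * (R * (1 + ‖P.φ ω‖)) + 2 * C * (R * (1 + ‖P.φ ω‖)) ^ 2 :=
        norm_lieBracket_lieBracket_le (hr.smooth₀ ω t ht) (hr.smooth₁ ω t ht) (hR h hc ω t ht)
          (hR P.f₀ hb.f₀_le ω t ht) (hR P.f₁ hb.f₁_le ω t ht)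
          (norm_fderiv_le_of_lipschitz ℝ (hK ω)) (norm_fderiv_le_of_lipschitz ℝ (hb.f₀_lip ω))
          (norm_fderiv_le_of_lipschitz ℝ (hb.f₁_lip ω)) (hω t ht).1 (hω t ht).2
    _ = 4 * K ^ 2 * R * (1 + ‖P.φ ω‖) + 2 * C * R ^ 2 * (1 + ‖P.φ ω‖) ^ 2 := by ring
    _ ≤ 4 * K ^ 2 * R * (1 + ‖P.φ ω‖) ^ 2 + 2 * C * R ^ 2 * (1 + ‖P.φ ω‖) ^ 2 := by gcongr
    _ = (4 * K ^ 2 * R + 2 * C * R ^ 2) * (1 + ‖P.φ ω‖) ^ 2 := by ring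

end IsRegular

theorem IsBoundedCostate.singular [IsFiniteMeasure μ]
    (hq : P.IsBoundedCostate μ w x q B) (h0 : P.H0) (hφ : MemLp P.φ 2 μ)
    (hr : P.IsRegular μ w x) {a b : ℝ} (hab : Ioo a b ⊆ Icc P.t₀ P.T)
    (hΨ : ∀ t ∈ Ioo a b, P.switching μ x q t = 0) :
    ∀ᵐ t ∂volume.restrict (Ioo a b),
      Integrable (P.bracket₀ x q t) μ ∧ Integrable (P.bracket₁ x q t) μ ∧
      (∫ ω, P.bracket₀ x q t ω ∂μ) + w t * (∫ ω, P.bracket₁ x q t ω ∂μ) = 0 := by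
  obtain ⟨c, K, hb⟩ := h0.exists_uniformBounds
  have tame₀ := hr.isTame_bracket_bracket h0 hb hb.f₀_le hb.f₀_lip
    (fun ω _ => hr.differentiableAt_f₀ ω) h0.measurable_f₀
  have tame₁ := hr.isTame_bracket_bracket h0 hb hb.f₁_le hb.f₁_lip
    (fun ω _ => hr.differentiableAt_f₁ ω) h0.measurable_f₁
  have hΨ' := hasW11Deriv_avgPairing h0 hφ hr hq
    (fun ω t ht => (hr.smooth₁ ω t ht).of_le one_le_two) (hr.isTame_f₁ h0) (hr.isTame_bracket h0)
    isTame_bracket_self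
  have hΨ'' := hasW11Deriv_avgPairing h0 hφ hr hq (fun ω _ ht => hr.contDiffAt_bracket ω ht)
    (hr.isTame_bracket h0) tame₀ tame₁
  have hΨ'_ae : ∀ᵐ t ∂volume.restrict (Ioo a b), avgPairing μ x q (bracket P.f₀ P.f₁) t = 0 := by
    filter_upwards [hΨ'.ae_eq_zero_of_eqOn_zero hab hΨ] with t ht
    simpa [avgPairing, bracket] using ht
  have hΨ'_eq : ∀ t ∈ Ioo a b, avgPairing μ x q (bracket P.f₀ P.f₁) t = 0 :=
    Measure.eqOn_open_of_ae_eq (g := fun _ => 0) hΨ'_ae isOpen_Ioo (hΨ''.continuousOn.mono hab)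
      continuousOn_const
  filter_upwards [hΨ''.ae_eq_zero_of_eqOn_zero hab hΨ'_eq, ae_restrict_mem measurableSet_Ioo]
    with t ht htm
  exact ⟨tame₀.integrable h0 hφ hr hq (hab htm), tame₁.integrable h0 hφ hr hq (hab htm), ht⟩

end AffineProblem

/-! ### Convex variations of the control -/

theorem tendsto_inv_smul_linearization_error {E F : Type*} [NormedAddCommGroup E]
    [NormedSpace ℝ E] [NormedAddCommGroup F] [NormedSpace ℝ F] {f : E → F} {f' : E →L[ℝ] F}
    {x : E} (hf : HasFDerivAt f f' x) {y : ℕ → E} {ε : ℕ → ℝ} {C : ℝ}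
    (hε : Tendsto ε atTop (𝓝 0)) (hy : ∀ k, ‖y k - x‖ ≤ C * ‖ε k‖) :
    Tendsto (fun k => (ε k)⁻¹ • (f (y k) - f x - f' (y k - x))) atTop (𝓝 0) := by
  have hO : (fun k => y k - x) =O[atTop] ε := .of_bound C (Eventually.of_forall hy)
  have hyx : Tendsto y atTop (𝓝 x) := by simpa using (hO.trans_tendsto hε).add_const x
  exact ((hf.isLittleO.comp_tendsto hyx).trans_isBigO hO).tendsto_inv_smul_nhds_zero

namespace AffineProblem

variable {n : ℕ} {Ω : Type*} {P : AffineProblem n Ω} {w v : ℝ → ℝ} {x : ℝ → Ω → StateSpace n}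

/-- The control `w + ε (v - w)`. -/
def convexControl (w v : ℝ → ℝ) (ε : ℝ) (t : ℝ) : ℝ := w t + ε * (v t - w t)

theorem IsStrictControl.convexControl (hw : P.IsStrictControl w) (hv : P.IsStrictControl v)
    {ε : ℝ} (hε : ε ∈ Icc (0 : ℝ) 1) : P.IsStrictControl (convexControl w v ε) :=
  ⟨hw.1.add ((hv.1.sub hw.1).const_mul ε), fun t =>
    (convex_Icc P.umin P.umax).add_smul_sub_mem (hw.2 t) (hv.2 t) hε⟩

theorem IsStrictControl.abs_sub_le (hw : P.IsStrictControl w) (hv : P.IsStrictControl v) (t : ℝ) :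
    |v t - w t| ≤ P.umax - P.umin :=
  abs_sub_le_of_le_of_le (hv.2 t).1 (hv.2 t).2 (hw.2 t).1 (hw.2 t).2

theorem IsStrictControl.abs_convexControl_sub_le (hw : P.IsStrictControl w)
    (hv : P.IsStrictControl v) {ε : ℝ} (hε : 0 ≤ ε) (t : ℝ) :
    |AffineProblem.convexControl w v ε t - w t| ≤ ε * (P.umax - P.umin) := by
  rw [AffineProblem.convexControl, add_sub_cancel_left, abs_mul, abs_of_nonneg hε]
  exact mul_le_mul_of_nonneg_left (hw.abs_sub_le hv t) hε

/-- Arcs `y k` driven by the controls `w + ε k (v - w)`, where `ε k ∈ (0, 1]` tends to `0`. -/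
structure IsVariation (P : AffineProblem n Ω) (w v : ℝ → ℝ) (ε : ℕ → ℝ)
    (y : ℕ → ℝ → Ω → StateSpace n) : Prop where
  mem : ∀ k, ε k ∈ Ioc (0 : ℝ) 1
  tendsto : Tendsto ε atTop (𝓝 0)
  control : ∀ k, P.IsStrictControl (convexControl w v (ε k))
  adm : ∀ k, P.IsAdmissible (convexControl w v (ε k)) (y k)

/-- The error of the linearization in the state, at the process `(w, x)`, of the velocity of the
process `(w', y)`. -/
noncomputable def linError (P : AffineProblem n Ω) (w w' : ℝ → ℝ) (x y : ℝ → Ω → StateSpace n)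
    (t : ℝ) (ω : Ω) : StateSpace n :=
  P.dyn (y t ω) (w' t) ω - P.dyn (x t ω) (w t) ω - P.dynJac (x t ω) (w t) ω (y t ω - x t ω)

theorem UniformBounds.norm_linError_le {c K : NNReal} (hb : P.UniformBounds c K)
    {w' : ℝ → ℝ} {y : ℝ → Ω → StateSpace n} {t : ℝ} {ω : Ω} {R : ℝ}
    (hw : w t ∈ Icc P.umin P.umax) (hy : ‖y t ω - x t ω‖ ≤ R)
    (hd : ‖P.dyn (y t ω) (w' t) ω - P.dyn (x t ω) (w t) ω‖ ≤ R) :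
    ‖P.linError w w' x y t ω‖ ≤ (1 + K) * R := by
  rw [one_add_mul]
  exact norm_sub_le_of_le hd (ContinuousLinearMap.le_of_opNorm_le_of_le _
    (hb.norm_dynJac_le hw _ _) hy)

theorem linError_convexControl (ε : ℝ) (y : ℝ → Ω → StateSpace n) (t : ℝ) (ω : Ω) :
    P.linError w (convexControl w v ε) x y t ω =
      P.linError w w x y t ω + ε • (v t - w t) • P.f₁ (y t ω) ω := by
  simp only [linError, dyn, convexControl, add_smul, mul_smul]
  abel

/-- The control that is `umax` where `S > 0`, `umin` where `S < 0`, and `w` elsewhere. -/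
noncomputable def bangControl (P : AffineProblem n Ω) (S w : ℝ → ℝ) (t : ℝ) : ℝ :=
  if 0 < S t then P.umax else if S t < 0 then P.umin else w t

theorem IsStrictControl.bangControl {S : ℝ → ℝ} (hw : P.IsStrictControl w) (hS : Measurable S) :
    P.IsStrictControl (P.bangControl S w) := by
  refine ⟨.ite (measurableSet_lt measurable_const hS) measurable_const
    (.ite (measurableSet_lt hS measurable_const) measurable_const hw.1), fun t => ?_⟩
  unfold AffineProblem.bangControl
  split_ifs
  exacts [right_mem_Icc.2 P.control_lt.le, left_mem_Icc.2 P.control_lt.le, hw.2 t]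

theorem bangControl_sub_mul_nonneg {S : ℝ → ℝ} {t : ℝ} (hw : w t ∈ Icc P.umin P.umax) :
    0 ≤ (P.bangControl S w t - w t) * S t := by
  unfold bangControl
  split_ifs with hpos hneg
  · exact mul_nonneg (sub_nonneg.2 hw.2) hpos.le
  · exact mul_nonneg_of_nonpos_of_nonpos (sub_nonpos.2 hw.1) hneg.le
  · simp

variable [MeasurableSpace Ω] {μ : Measure Ω} {q : ℝ → Ω → StateSpace n} {B : ℝ}
  {ε : ℕ → ℝ} {y : ℕ → ℝ → Ω → StateSpace n}

theorem H0.exists_isVariation (h0 : P.H0) (hw : P.IsStrictControl w) (hv : P.IsStrictControl v) :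
    ∃ ε y, P.IsVariation w v ε y := by
  have hmem : ∀ k : ℕ, 1 / ((k : ℝ) + 1) ∈ Ioc (0 : ℝ) 1 := fun k =>
    ⟨Nat.one_div_pos_of_nat, by simpa using Nat.one_div_le_one_div (α := ℝ) k.zero_le⟩
  have hc := fun k => hw.convexControl hv (Ioc_subset_Icc_self (hmem k))
  choose y hy using fun k => h0.exists_isAdmissible (hc k)
  exact ⟨_, y, hmem, tendsto_one_div_add_atTop_nhds_zero_nat, hc, hy⟩

theorem IsVariation.exists_norm_sub_le {c K : NNReal} (hy : P.IsVariation w v ε y)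
    (hb : P.UniformBounds c K) (hr : P.IsRegular μ w x) (hv : P.IsStrictControl v) :
    ∃ C : NNReal, ∀ k ω, ∀ t ∈ Icc P.t₀ P.T,
      ‖y k t ω - x t ω‖ ≤ C * (1 + ‖P.φ ω‖) * ε k ∧
      ‖P.dyn (y k t ω) (convexControl w v (ε k) t) ω - P.dyn (x t ω) (w t) ω‖ ≤
        C * (1 + ‖P.φ ω‖) * ε k := by
  obtain ⟨C, hC⟩ := hb.exists_stability
  refine ⟨C * (P.umax - P.umin).toNNReal, fun k ω t ht => ?_⟩
  have h := hC w _ x (y k) _ hr.control (hy.control k)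
    (hr.control.abs_convexControl_sub_le hv (hy.mem k).1.le) hr.adm (hy.adm k) ω t ht
  have hrw : C * (ε k * (P.umax - P.umin)) * (1 + ‖P.φ ω‖) =
      ↑(C * (P.umax - P.umin).toNNReal) * (1 + ‖P.φ ω‖) * ε k := by
    rw [NNReal.coe_mul, Real.coe_toNNReal _ (sub_nonneg.2 P.control_lt.le)]
    ring
  rwa [hrw] at h

/-- The terms linear in `y - x` cancel by the adjoint equation. -/
theorem IsBoundedCostate.hasW11Deriv_inner_sub {w' : ℝ → ℝ} {y : ℝ → Ω → StateSpace n}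
    (hq : P.IsBoundedCostate μ w x q B) (h0 : P.H0) (hr : P.IsRegular μ w x)
    (hw' : P.IsStrictControl w') (hy : P.IsAdmissible w' y) (ω : Ω) :
    HasW11Deriv P.t₀ P.T (fun t => inner ℝ (q t ω) (y t ω - x t ω))
      (fun t => inner ℝ (q t ω) (P.linError w w' x y t ω)) := by
  obtain ⟨c, K, hb⟩ := h0.exists_uniformBounds
  obtain ⟨C, hC⟩ := hb.exists_stability
  refine ((hq.adjoint ω).inner_comp (h := id) ((hy.2 ω).2.sub (hr.adm.2 ω).2) P.time_lt.le
    (C := K * B) (fun t ht => ?_)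
    (fun t ht => (hC w w' x y _ hr.control hw' (hr.control.abs_sub_le hw') hr.adm hy ω t ht).2)
    fun t _ => contDiff_id.contDiffAt).congr_ae P.time_lt.le (ae_of_all _ fun t => ?_)
  · rw [norm_neg]
    exact (hb.norm_adjoint_dynJac_le (hr.control.2 t) _ _ _).trans
      (mul_le_mul_of_nonneg_left (hq.bound ω t ht) K.coe_nonneg)
  · simp only [linError, fderiv_id, id, ContinuousLinearMap.coe_id', inner_neg_left,
      ContinuousLinearMap.adjoint_inner_left, inner_sub_right, map_sub]
    ring

theorem IsVariation.tendsto_linError (hy : P.IsVariation w v ε y) (h0 : P.H0)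
    (hr : P.IsRegular μ w x) (hv : P.IsStrictControl v) (ω : Ω) {t : ℝ}
    (ht : t ∈ Icc P.t₀ P.T) :
    Tendsto (fun k => (ε k)⁻¹ • P.linError w (convexControl w v (ε k)) x (y k) t ω) atTop
      (𝓝 ((v t - w t) • P.f₁ (x t ω) ω)) := by
  obtain ⟨c, K, hb⟩ := h0.exists_uniformBounds
  obtain ⟨C, hC⟩ := hy.exists_norm_sub_le hb hr hv
  have hyx : ∀ k, ‖y k t ω - x t ω‖ ≤ C * (1 + ‖P.φ ω‖) * ‖ε k‖ := fun k => by
    rw [Real.norm_of_nonneg (hy.mem k).1.le]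
    exact (hC k ω t ht).1
  have hlim : Tendsto (fun k => y k t ω) atTop (𝓝 (x t ω)) :=
    tendsto_iff_norm_sub_tendsto_zero.2 (squeeze_zero (fun _ => norm_nonneg _) hyx
      (by simpa using hy.tendsto.norm.const_mul (C * (1 + ‖P.φ ω‖))))
  have hjac : HasFDerivAt (fun z => P.dyn z (w t) ω) (P.dynJac (x t ω) (w t) ω) (x t ω) :=
    (hasFDerivAt_dyn (hr.differentiableAt_f₀ ω ht) (hr.differentiableAt_f₁ ω ht)
      (w t)).differentiableAt.hasFDerivAt
  have hsum := (tendsto_inv_smul_linearization_error hjac hy.tendsto hyx).add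
    ((((hb.f₁_lip ω).continuous.tendsto _).comp hlim).const_smul (v t - w t))
  rw [zero_add] at hsum
  refine hsum.congr fun k => ?_
  rw [linError_convexControl, smul_add, inv_smul_smul₀ (hy.mem k).1.ne']
  rfl

theorem IsVariation.tendsto_inner_terminal (hy : P.IsVariation w v ε y) (h0 : P.H0)
    (hr : P.IsRegular μ w x) (hv : P.IsStrictControl v) (hq : P.IsBoundedCostate μ w x q B)
    (ω : Ω) :
    Tendsto (fun k => (ε k)⁻¹ * inner ℝ (q P.T ω) (y k P.T ω - x P.T ω)) atTop
      (𝓝 (∫ t in P.t₀..P.T, (v t - w t) * inner ℝ (q t ω) (P.f₁ (x t ω) ω))) := by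
  have hab := P.time_lt.le
  obtain ⟨c, K, hb⟩ := h0.exists_uniformBounds
  obtain ⟨C, hC⟩ := hy.exists_norm_sub_le hb hr hv
  have hW := fun k => hq.hasW11Deriv_inner_sub h0 hr (hy.control k) (hy.adm k) ω
  have hend : ∀ k, (ε k)⁻¹ * inner ℝ (q P.T ω) (y k P.T ω - x P.T ω) = ∫ t in P.t₀..P.T,
      (ε k)⁻¹ * inner ℝ (q t ω) (P.linError w (convexControl w v (ε k)) x (y k) t ω) := by
    intro k
    have hk := (hW k).2 P.T (right_mem_Icc.2 hab)
    beta_reduce at hk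
    rw [(hr.adm.2 ω).1, ((hy.adm k).2 ω).1, sub_self, inner_zero_right, zero_add] at hk
    rw [hk, intervalIntegral.integral_const_mul]
  simp only [hend]
  refine intervalIntegral.tendsto_integral_filter_of_dominated_convergence
    (fun _ => B * ((1 + K) * (C * (1 + ‖P.φ ω‖))))
    (Eventually.of_forall fun k => ((hW k).1.const_mul _).def'.aestronglyMeasurable)
    (Eventually.of_forall fun k => ae_of_all _ fun t ht => ?_)
    intervalIntegrable_const (ae_of_all _ fun t ht => ?_)
  all_goals
    rw [uIoc_of_le hab] at ht
    replace ht := Ioc_subset_Icc_self ht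
  · have hbound := hq.norm_inner_le (ω := ω) ht
      (hb.norm_linError_le (hr.control.2 t) (hC k ω t ht).1 (hC k ω t ht).2)
    rw [norm_mul, norm_inv, Real.norm_of_nonneg (hy.mem k).1.le, inv_mul_le_iff₀ (hy.mem k).1]
    exact hbound.trans_eq (by ring)
  · have hlim := (tendsto_const_nhds (x := q t ω)).inner (𝕜 := ℝ)
      (hy.tendsto_linError h0 hr hv ω ht)
    simpa only [inner_smul_right] using hlim

theorem IsVariation.tendsto_cost_quotient (hy : P.IsVariation w v ε y) (h0 : P.H0)
    (hr : P.IsRegular μ w x) (hv : P.IsStrictControl v) (hq : P.IsBoundedCostate μ w x q B)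
    (ω : Ω) :
    Tendsto (fun k => (ε k)⁻¹ * (P.g (y k P.T ω) ω - P.g (x P.T ω) ω)) atTop
      (𝓝 (-∫ t in P.t₀..P.T, (v t - w t) * inner ℝ (q t ω) (P.f₁ (x t ω) ω))) := by
  obtain ⟨c, K, hb⟩ := h0.exists_uniformBounds
  obtain ⟨C, hC⟩ := hy.exists_norm_sub_le hb hr hv
  have hyx : ∀ k, ‖y k P.T ω - x P.T ω‖ ≤ C * (1 + ‖P.φ ω‖) * ‖ε k‖ := fun k => by
    rw [Real.norm_of_nonneg (hy.mem k).1.le]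
    exact (hC k ω P.T (right_mem_Icc.2 P.time_lt.le)).1
  have hdiff := (tendsto_inv_smul_linearization_error (hr.diff_g ω).hasFDerivAt hy.tendsto
    hyx).sub (hy.tendsto_inner_terminal h0 hr hv hq ω)
  rw [zero_sub] at hdiff
  refine hdiff.congr fun k => ?_
  rw [← inner_gradient_eq_fderiv, ← hq.terminal ω, inner_neg_right, real_inner_comm, smul_eq_mul]
  ring

theorem H0.integrable_g_comp [IsFiniteMeasure μ] (h0 : P.H0) {z : Ω → StateSpace n}
    (hz : AEStronglyMeasurable z μ) : Integrable (fun ω => P.g (z ω) ω) μ := by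
  obtain ⟨M, -, hM⟩ := h0.bound_g
  exact .of_bound (h0.meas_g.comp_aemeasurable
    (hz.aemeasurable.prodMk aemeasurable_id)).aestronglyMeasurable M (ae_of_all _ fun ω => hM _ ω)

variable [IsFiniteMeasure μ]

theorem IsVariation.tendsto_cost (hy : P.IsVariation w v ε y) (h0 : P.H0)
    (hφ : MemLp P.φ 2 μ) (hr : P.IsRegular μ w x) (hv : P.IsStrictControl v)
    (hq : P.IsBoundedCostate μ w x q B) :
    Tendsto (fun k => (ε k)⁻¹ * (P.cost μ (y k) - P.cost μ x)) atTop
      (𝓝 (-∫ ω, (∫ t in P.t₀..P.T, (v t - w t) * inner ℝ (q t ω) (P.f₁ (x t ω) ω)) ∂μ)) := by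
  have hT : P.T ∈ Icc P.t₀ P.T := right_mem_Icc.2 P.time_lt.le
  obtain ⟨c, K, hb⟩ := h0.exists_uniformBounds
  obtain ⟨C, hC⟩ := hy.exists_norm_sub_le hb hr hv
  obtain ⟨k, hk, hg⟩ := h0.lip_g
  have hgx := h0.integrable_g_comp
    (h0.aestronglyMeasurable_arc hφ.aestronglyMeasurable hr.control hr.adm P.T hT)
  have hgy := fun j => h0.integrable_g_comp
    (h0.aestronglyMeasurable_arc hφ.aestronglyMeasurable (hy.control j) (hy.adm j) P.T hT)
  simp only [cost, ← integral_sub (hgy _) hgx, ← integral_const_mul, ← integral_neg]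
  refine tendsto_integral_of_dominated_convergence (fun ω => k * (C * (1 + ‖P.φ ω‖)))
    (fun j => (((hgy j).sub hgx).const_mul _).aestronglyMeasurable)
    ((((integrable_const 1).add (hφ.integrable one_le_two).norm).const_mul _).const_mul k)
    (fun j => ae_of_all _ fun ω => ?_)
    (ae_of_all _ fun ω => hy.tendsto_cost_quotient h0 hr hv hq ω)
  rw [norm_mul, norm_inv, Real.norm_of_nonneg (hy.mem j).1.le, inv_mul_le_iff₀ (hy.mem j).1]
  calc ‖P.g (y j P.T ω) ω - P.g (x P.T ω) ω‖ ≤ k * (C * (1 + ‖P.φ ω‖) * ε j) :=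
        (hg _ _ ω).trans (mul_le_mul_of_nonneg_left (hC j ω P.T hT).1 (zero_le_one.trans hk))
    _ = ε j * (k * (C * (1 + ‖P.φ ω‖))) := by ring

theorem IsBoundedCostate.integrable_variation (hq : P.IsBoundedCostate μ w x q B) (h0 : P.H0)
    (hφ : MemLp P.φ 2 μ) (hr : P.IsRegular μ w x) (hv : P.IsStrictControl v) :
    Integrable (fun z : ℝ × Ω => (v z.1 - w z.1) * inner ℝ (q z.1 z.2) (P.f₁ (x z.1 z.2) z.2))
      ((volume.restrict (Icc P.t₀ P.T)).prod μ) :=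
  ((hr.isTame_f₁ h0).integrable_prod h0 hφ hr hq).bdd_mul (c := P.umax - P.umin)
    ((hv.1.sub hr.control.1).comp measurable_fst).aestronglyMeasurable
    (ae_of_all _ fun z => hr.control.abs_sub_le hv z.1)

theorem IsBoundedCostate.integrable_mul_switching (hq : P.IsBoundedCostate μ w x q B) (h0 : P.H0)
    (hφ : MemLp P.φ 2 μ) (hr : P.IsRegular μ w x) (hv : P.IsStrictControl v) :
    Integrable (fun t => (v t - w t) * P.switching μ x q t) (volume.restrict (Icc P.t₀ P.T)) := by
  simpa only [switching, integral_const_mul] using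
    (hq.integrable_variation h0 hφ hr hv).integral_prod_left

theorem IsBoundedCostate.integral_mul_switching (hq : P.IsBoundedCostate μ w x q B) (h0 : P.H0)
    (hφ : MemLp P.φ 2 μ) (hr : P.IsRegular μ w x) (hv : P.IsStrictControl v) :
    ∫ t in Icc P.t₀ P.T, (v t - w t) * P.switching μ x q t =
      ∫ ω, (∫ t in P.t₀..P.T, (v t - w t) * inner ℝ (q t ω) (P.f₁ (x t ω) ω)) ∂μ := by
  simp only [switching, ← integral_const_mul, intervalIntegral.integral_of_le P.time_lt.le,
    ← integral_Icc_eq_integral_Ioc]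
  exact integral_integral_swap
    (f := fun t ω => (v t - w t) * inner ℝ (q t ω) (P.f₁ (x t ω) ω))
    (hq.integrable_variation h0 hφ hr hv)

/-! ### Uniform local minimizers and the bang-bang principle -/

/-- Optimality of a strict control among the strict controls that are uniformly close to it. -/
def IsUniformLocalMin (P : AffineProblem n Ω) (μ : Measure Ω) (w : ℝ → ℝ)
    (x : ℝ → Ω → StateSpace n) : Prop :=
  ∃ η : ℝ, 0 < η ∧ ∀ v y, P.IsStrictControl v → P.IsAdmissible v y → (∀ t, |v t - w t| ≤ η) →
    P.cost μ x ≤ P.cost μ y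

theorem IsUniformLocalMin.integral_mul_switching_nonpos (hmin : P.IsUniformLocalMin μ w x)
    (h0 : P.H0) (hφ : MemLp P.φ 2 μ) (hr : P.IsRegular μ w x)
    (hq : P.IsBoundedCostate μ w x q B) (hv : P.IsStrictControl v) :
    ∫ t in Icc P.t₀ P.T, (v t - w t) * P.switching μ x q t ≤ 0 := by
  obtain ⟨η, hη, hopt⟩ := hmin
  obtain ⟨ε, y, hy⟩ := h0.exists_isVariation hr.control hv
  have hlim := hy.tendsto_cost h0 hφ hr hv hq
  rw [← hq.integral_mul_switching h0 hφ hr hv] at hlim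
  have hsmall : Tendsto (fun k => ε k * (P.umax - P.umin)) atTop (𝓝 0) := by
    simpa using hy.tendsto.mul_const (P.umax - P.umin)
  refine neg_nonneg.1 (ge_of_tendsto hlim ?_)
  filter_upwards [hsmall.eventually (ge_mem_nhds hη)] with k hk
  exact mul_nonneg (inv_nonneg.2 (hy.mem k).1.le) (sub_nonneg.2 (hopt _ (y k) (hy.control k)
    (hy.adm k) fun t => (hr.control.abs_convexControl_sub_le hv (hy.mem k).1.le t).trans hk))

theorem IsUniformLocalMin.bang (hmin : P.IsUniformLocalMin μ w x) (h0 : P.H0)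
    (hφ : MemLp P.φ 2 μ) (hr : P.IsRegular μ w x) (hq : P.IsBoundedCostate μ w x q B) :
    ∀ᵐ t ∂volume.restrict (Icc P.t₀ P.T),
      (0 < P.switching μ x q t → w t = P.umax) ∧ (P.switching μ x q t < 0 → w t = P.umin) := by
  have hΨ : AEStronglyMeasurable (P.switching μ x q) (volume.restrict (Icc P.t₀ P.T)) :=
    ((hr.isTame_f₁ h0).integrable_prod h0 hφ hr hq).integral_prod_left.aestronglyMeasurable
  set S := hΨ.mk _
  have hv := hr.control.bangControl hΨ.stronglyMeasurable_mk.measurable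
  have hnonneg : ∀ᵐ t ∂volume.restrict (Icc P.t₀ P.T),
      0 ≤ (P.bangControl S w t - w t) * P.switching μ x q t := by
    filter_upwards [hΨ.ae_eq_mk] with t hS
    rw [hS]
    exact bangControl_sub_mul_nonneg (hr.control.2 t)
  have hzero := (integral_eq_zero_iff_of_nonneg_ae hnonneg
    (hq.integrable_mul_switching h0 hφ hr hv)).1
    (le_antisymm (hmin.integral_mul_switching_nonpos h0 hφ hr hq hv)
      (integral_nonneg_of_ae hnonneg))
  filter_upwards [hzero, hΨ.ae_eq_mk] with t ht hS
  rw [hS, Pi.zero_apply, mul_eq_zero, sub_eq_zero] at ht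
  rw [hS]
  refine ⟨fun hpos => ?_, fun hneg => ?_⟩
  · rw [← ht.resolve_right hpos.ne', bangControl, if_pos hpos]
  · rw [← ht.resolve_right hneg.ne, bangControl, if_neg hneg.not_gt, if_pos hneg]

end AffineProblem

/-! ### Local minimizers -/

theorem HasW11Deriv.norm_deriv_le {X : Type*} [NormedAddCommGroup X] [NormedSpace ℝ X]
    {a b C : ℝ} {z v : ℝ → X} (h : HasW11Deriv a b z v) (hC : ∀ t ∈ Icc a b, ‖v t‖ ≤ C)
    {t : ℝ} (ht : t ∈ Ioo a b) : ‖deriv z t‖ ≤ C := by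
  have ht' := Ioo_subset_Icc_self ht
  refine norm_deriv_le_of_lip' ((norm_nonneg _).trans (hC t ht')) ?_
  filter_upwards [Icc_mem_nhds ht.1 ht.2] with s hs using h.norm_sub_le hC ht' hs

theorem lintegral_Icc_le_ofReal {a b R : ℝ} {f : ℝ → ℝ≥0∞} (hR : 0 ≤ R)
    (hf : ∀ t ∈ Ioo a b, f t ≤ ENNReal.ofReal R) :
    ∫⁻ t in Icc a b, f t ≤ ENNReal.ofReal (R * (b - a)) := by
  rw [← restrict_Ioo_eq_restrict_Icc, ENNReal.ofReal_mul hR, ← Real.volume_Ioo,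
    ← setLIntegral_const]
  exact setLIntegral_mono measurable_const hf

theorem w11Norm_le {X : Type*} [NormedAddCommGroup X] [NormedSpace ℝ X] {a b R : ℝ}
    {z v : ℝ → X} (hR : 0 ≤ R) (h : HasW11Deriv a b z v) (hz : ∀ t ∈ Icc a b, ‖z t‖ ≤ R)
    (hv : ∀ t ∈ Icc a b, ‖v t‖ ≤ R) : w11Norm a b z ≤ ENNReal.ofReal (2 * (R * (b - a))) := by
  rw [w11Norm, ENNReal.ofReal_mul zero_le_two, ENNReal.ofReal_ofNat, two_mul]
  refine add_le_add (lintegral_Icc_le_ofReal hR fun t ht => ?_)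
    (lintegral_Icc_le_ofReal hR fun t ht => ?_)
  all_goals
    rw [← ofReal_norm]
    refine ENNReal.ofReal_le_ofReal ?_
  exacts [hz t (Ioo_subset_Icc_self ht), h.norm_deriv_le hv ht]

theorem w11L2Norm_le {n : ℕ} {Ω : Type*} [MeasurableSpace Ω] {μ : Measure Ω} {a b R : ℝ}
    {z v : ℝ → Ω → StateSpace n} {h : Ω → ℝ} (hR : 0 ≤ R) (hh : MemLp h 2 μ)
    (hzv : ∀ ω, HasW11Deriv a b (fun t => z t ω) (fun t => v t ω))
    (hz : ∀ ω, ∀ t ∈ Icc a b, ‖z t ω‖ ≤ R * h ω) (hv : ∀ ω, ∀ t ∈ Icc a b, ‖v t ω‖ ≤ R * h ω) :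
    w11L2Norm μ a b z ≤ ENNReal.ofReal (2 * (R * (eLpNorm h 2 μ).toReal * (b - a))) := by
  have hnorm : ∀ y : Ω → StateSpace n, (∀ ω, ‖y ω‖ ≤ R * h ω) →
      eLpNorm y 2 μ ≤ ENNReal.ofReal (R * (eLpNorm h 2 μ).toReal) := fun y hy => by
    rw [ENNReal.ofReal_mul hR, ENNReal.ofReal_toReal hh.2.ne]
    exact eLpNorm_le_mul_eLpNorm_of_ae_le_mul (ae_of_all _ fun ω => (hy ω).trans
      (mul_le_mul_of_nonneg_left (Real.le_norm_self _) hR)) 2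
  rw [w11L2Norm, ENNReal.ofReal_mul zero_le_two, ENNReal.ofReal_ofNat, two_mul]
  exact add_le_add
    (lintegral_Icc_le_ofReal (by positivity) fun t ht =>
      hnorm _ fun ω => hz ω t (Ioo_subset_Icc_self ht))
    (lintegral_Icc_le_ofReal (by positivity) fun t ht =>
      hnorm _ fun ω => (hzv ω).norm_deriv_le (hv ω) ht)

namespace AffineProblem

variable {n : ℕ} {Ω : Type*} {P : AffineProblem n Ω} {u w : ℝ → ℝ} {x : ℝ → Ω → StateSpace n}
  [MeasurableSpace Ω] {μ : Measure Ω} {q : ℝ → Ω → StateSpace n} {B : ℝ}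

theorem IsW11LocalMin.isUniformLocalMin [MetricSpace Ω] (hmin : P.IsW11LocalMin μ u x)
    (h0 : P.H0) {R : ℝ} (hφ : ∀ ω ∈ μ.support, ‖P.φ ω‖ ≤ R) (hw : P.IsStrictControl w)
    (hx : P.IsAdmissible w x) : P.IsUniformLocalMin μ w x := by
  obtain ⟨-, e, he, hopt⟩ := hmin
  obtain ⟨c, K, hb⟩ := h0.exists_uniformBounds
  obtain ⟨C, hstab⟩ := hb.exists_stability
  obtain ⟨η, hη, hle⟩ := exists_pos_mul_lt he (2 * (C * (1 + R) * (P.T - P.t₀)))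
  refine ⟨η, hη, fun v y hv hy hvw => hopt v y hy fun ω hω => ?_⟩
  have hbound : C * η * (1 + ‖P.φ ω‖) ≤ C * η * (1 + R) := by
    gcongr
    exact hφ ω hω
  have hclose := hstab w v x y η hw hv hvw hx hy ω
  refine (w11Norm_le (le_trans (by positivity) hbound) ((hx.2 ω).2.sub (hy.2 ω).2)
    (fun t ht => ?_) (fun t ht => ?_)).trans ?_
  · rw [norm_sub_rev]
    exact (hclose t ht).1.trans hbound
  · rw [norm_sub_rev]
    exact (hclose t ht).2.trans hbound
  · exact ENNReal.ofReal_le_ofReal (le_trans (le_of_eq (by ring)) hle.le)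

theorem IsW11LocalMinL2.isUniformLocalMin [IsFiniteMeasure μ] (hmin : P.IsW11LocalMinL2 μ u x)
    (h0 : P.H0) (hφ : MemLp P.φ 2 μ) (hw : P.IsStrictControl w)
    (hx : P.IsAdmissible w x) : P.IsUniformLocalMin μ w x := by
  obtain ⟨-, e, he, hopt⟩ := hmin
  obtain ⟨c, K, hb⟩ := h0.exists_uniformBounds
  obtain ⟨C, hstab⟩ := hb.exists_stability
  have hmem : MemLp (fun ω => 1 + ‖P.φ ω‖) 2 μ := (memLp_const (1 : ℝ)).add hφ.norm
  set N := (eLpNorm (fun ω => 1 + ‖P.φ ω‖) 2 μ).toReal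
  obtain ⟨η, hη, hle⟩ := exists_pos_mul_lt he (2 * (C * N * (P.T - P.t₀)))
  refine ⟨η, hη, fun v y hv hy hvw => hopt v y hy ?_⟩
  have hclose := hstab w v x y η hw hv hvw hx hy
  refine (w11L2Norm_le (R := C * η) (by positivity) hmem
    (fun ω => (hx.2 ω).2.sub (hy.2 ω).2) (fun ω t ht => ?_) (fun ω t ht => ?_)).trans ?_
  · rw [norm_sub_rev]
    exact (hclose ω t ht).1
  · rw [norm_sub_rev]
    exact (hclose ω t ht).2
  · exact ENNReal.ofReal_le_ofReal (le_trans (le_of_eq (by ring)) hle.le)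

theorem ControlCharacterization.congr {p : ℝ → Ω → StateSpace n}
    (h : P.ControlCharacterization μ w x q) (huw : u =ᵐ[volume.restrict (Icc P.t₀ P.T)] w)
    (hpq : ∀ t ∈ Icc P.t₀ P.T, p t =ᵐ[μ] q t) : P.ControlCharacterization μ u x p := by
  have hpair {t : ℝ} (ht : t ∈ Icc P.t₀ P.T) (V : Ω → StateSpace n) :
      (fun ω => inner ℝ (p t ω) (V ω)) =ᵐ[μ] fun ω => inner ℝ (q t ω) (V ω) := by
    filter_upwards [hpq t ht] with ω hω
    rw [hω]
  have hΨ : ∀ t ∈ Icc P.t₀ P.T, P.switching μ x p t = P.switching μ x q t := fun t ht =>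
    integral_congr_ae (hpair ht _)
  refine ⟨fun t ht => (h.switching_integrable t ht).congr (hpair ht _).symm, ?_,
    fun a b hab hzero => ?_⟩
  · filter_upwards [h.bang, huw, ae_restrict_mem measurableSet_Icc] with t hbang hu ht
    rwa [hΨ t ht, hu]
  · filter_upwards [h.singular a b hab fun t ht => hΨ t (hab ht) ▸ hzero t ht,
      ae_restrict_of_ae_restrict_of_subset hab huw, ae_restrict_mem measurableSet_Ioo]
      with t ⟨hint₀, hint₁, heq⟩ hu ht
    have h₀ : P.bracket₀ x p t =ᵐ[μ] P.bracket₀ x q t := hpair (hab ht) _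
    have h₁ : P.bracket₁ x p t =ᵐ[μ] P.bracket₁ x q t := hpair (hab ht) _
    refine ⟨hint₀.congr h₀.symm, hint₁.congr h₁.symm, ?_⟩
    rwa [integral_congr_ae h₀, integral_congr_ae h₁, hu]

theorem IsUniformLocalMin.controlCharacterization [IsFiniteMeasure μ]
    (hmin : P.IsUniformLocalMin μ w x) (h0 : P.H0) (hφ : MemLp P.φ 2 μ)
    (hr : P.IsRegular μ w x) (hq : P.IsBoundedCostate μ w x q B) :
    P.ControlCharacterization μ w x q :=
  ⟨fun _ ht => (hr.isTame_f₁ h0).integrable h0 hφ hr hq ht, hmin.bang h0 hφ hr hq,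
    fun _ _ hab hΨ => hq.singular h0 hφ hr hab hΨ⟩

end AffineProblem

/-! ### Uniqueness of the adjoint arc -/

/-- Testing the scalar equations at each time `t` with `W = z t` gives an integral inequality for
`‖z‖`. -/
theorem eq_zero_of_forall_hasW11Deriv_inner {H : Type*} [NormedAddCommGroup H]
    [InnerProductSpace ℝ H] {a b K : ℝ} {z v : ℝ → H} (hK : 0 ≤ K)
    (hz : ContinuousOn z (Icc a b))
    (h : ∀ W, HasW11Deriv a b (fun t => inner ℝ W (z t)) (fun t => inner ℝ W (v t)))
    (hv : ∀ᵐ t ∂volume.restrict (Icc a b), ‖v t‖ ≤ K * ‖z t‖) (hza : z a = 0) :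
    ∀ t ∈ Icc a b, z t = 0 := by
  have hint : ∀ t ∈ Icc a b, ‖z t‖ ≤ 0 + K * ∫ s in a..t, ‖z s‖ := by
    intro t ht
    have hzt : IntervalIntegrable (fun s => ‖z s‖) volume a t :=
      (hz.norm.mono (Icc_subset_Icc_right ht.2)).intervalIntegrable_of_Icc ht.1
    have hinner : ∀ᵐ s, s ∈ Ioc a t → ‖(inner ℝ (z t) (v s) : ℝ)‖ ≤ ‖z t‖ * (K * ‖z s‖) := by
      filter_upwards [(ae_restrict_iff' measurableSet_Icc).1 hv] with s hs hst
      exact (norm_inner_le_norm _ _).trans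
        (mul_le_mul_of_nonneg_left (hs ⟨hst.1.le, hst.2.trans ht.2⟩) (norm_nonneg _))
    have hsq := intervalIntegral.norm_integral_le_of_norm_le ht.1 hinner
      ((hzt.const_mul K).const_mul ‖z t‖)
    have htt := (h (z t)).2 t ht
    beta_reduce at htt
    rw [hza, inner_zero_right, zero_add, real_inner_self_eq_norm_mul_norm] at htt
    rw [← htt, intervalIntegral.integral_const_mul, intervalIntegral.integral_const_mul,
      norm_mul, norm_norm] at hsq
    rw [zero_add]
    rcases (norm_nonneg (z t)).eq_or_lt with h | h
    · rw [← h]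
      exact mul_nonneg hK (intervalIntegral.integral_nonneg ht.1 fun s _ => norm_nonneg _)
    · exact le_of_mul_le_mul_left hsq h
  intro t ht
  simpa only [zero_mul, norm_le_zero_iff] using le_mul_exp_of_le_add_integral hK hz.norm hint t ht

theorem eq_zero_of_forall_hasW11Deriv_inner_right {H : Type*} [NormedAddCommGroup H]
    [InnerProductSpace ℝ H] {a b K : ℝ} {z v : ℝ → H} (hK : 0 ≤ K)
    (hz : ContinuousOn z (Icc a b))
    (h : ∀ W, HasW11Deriv a b (fun t => inner ℝ W (z t)) (fun t => inner ℝ W (v t)))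
    (hv : ∀ᵐ t ∂volume.restrict (Icc a b), ‖v t‖ ≤ K * ‖z t‖) (hzb : z b = 0) :
    ∀ t ∈ Icc a b, z t = 0 := by
  intro t ht
  have hab : a ≤ b := ht.1.trans ht.2
  have hrefl : ∀ s ∈ Icc a b, a + b - s ∈ Icc a b := fun s hs =>
    ⟨by linarith [hs.2], by linarith [hs.1]⟩
  have hrev := eq_zero_of_forall_hasW11Deriv_inner (z := fun s => z (a + b - s))
    (v := fun s => -v (a + b - s)) hK (hz.comp (by fun_prop) hrefl)
    (fun W => by simpa only [inner_neg_right] using (h W).reverse hab)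
    (by simpa only [norm_neg] using (measurePreserving_reverse a b).quasiMeasurePreserving.ae hv)
    (by simpa only [add_sub_cancel_left] using hzb) (a + b - t) (hrefl t ht)
  simpa only [sub_sub_cancel] using hrev

theorem exists_Lp_ae_eq {ι Ω E : Type*} [MeasurableSpace Ω] {μ : Measure Ω}
    [NormedAddCommGroup E] {p : ℝ≥0∞} {s : Set ι} {f : ι → Ω → E}
    (hf : ∀ i ∈ s, MemLp (f i) p μ) : ∃ F : ι → Lp E p μ, ∀ i ∈ s, F i =ᵐ[μ] f i := by
  classical
  refine ⟨fun i => if hi : i ∈ s then (hf i hi).toLp else 0, fun i hi => ?_⟩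
  simpa only [dif_pos hi] using (hf i hi).coeFn_toLp

theorem inner_eq_integral_of_ae_eq {Ω E : Type*} [MeasurableSpace Ω] {μ : Measure Ω}
    [NormedAddCommGroup E] [InnerProductSpace ℝ E] (W : Lp E 2 μ) {F : Lp E 2 μ} {f : Ω → E}
    (hF : F =ᵐ[μ] f) : inner ℝ W F = ∫ ω, inner ℝ (W ω) (f ω) ∂μ := by
  rw [L2.inner_def]
  refine integral_congr_ae ?_
  filter_upwards [hF] with ω hω
  rw [hω]

namespace AffineProblem

variable {n : ℕ} {Ω : Type*} {P : AffineProblem n Ω} {u w : ℝ → ℝ} {x : ℝ → Ω → StateSpace n}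
  [MeasurableSpace Ω] {μ : Measure Ω} {q : ℝ → Ω → StateSpace n} {B : ℝ}

theorem IsCostate.eqOn_of_isBoundedCostate [MetricSpace Ω] {p : ℝ → Ω → StateSpace n}
    (hp : P.IsCostate μ u x p) (h0 : P.H0) (hr : P.IsRegular μ w x)
    (huw : u =ᵐ[volume.restrict (Icc P.t₀ P.T)] w) (hq : P.IsBoundedCostate μ w x q B)
    {ω : Ω} (hω : ω ∈ μ.support) : EqOn (fun t => p t ω) (fun t => q t ω) (Icc P.t₀ P.T) := by
  have hab := P.time_lt.le
  obtain ⟨K, hG⟩ := h0.exists_isCaratheodoryField_adjoint hr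
  have hpω : HasW11Deriv P.t₀ P.T (fun t => p t ω)
      (fun t => -ContinuousLinearMap.adjoint (P.dynJac (x t ω) (w t) ω) (p t ω)) := by
    refine (hp.adjoint_eq ω hω).congr_ae hab ?_
    filter_upwards [huw] with t ht
    rw [ht]
  refine (hG ω).eqOn_of_eq_right hab hpω (hq.adjoint ω) ?_
  rw [← neg_inj, hp.terminal ω hω, hq.terminal]

theorem IsBoundedCostate.norm_adjoint_le (hq : P.IsBoundedCostate μ w x q B) {c K : NNReal}
    (hb : P.UniformBounds c K) (hw : P.IsStrictControl w) (ω : Ω) {t : ℝ}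
    (ht : t ∈ Icc P.t₀ P.T) :
    ‖-ContinuousLinearMap.adjoint (P.dynJac (x t ω) (w t) ω) (q t ω)‖ ≤ K * B := by
  rw [norm_neg]
  exact (hb.norm_adjoint_dynJac_le (hw.2 t) _ _ _).trans
    (mul_le_mul_of_nonneg_left (hq.bound ω t ht) K.coe_nonneg)

theorem IsBoundedCostate.continuousOn_Lp [IsFiniteMeasure μ] (hq : P.IsBoundedCostate μ w x q B)
    (h0 : P.H0) (hw : P.IsStrictControl w) {Q : ℝ → Lp (StateSpace n) 2 μ}
    (hQ : ∀ t ∈ Icc P.t₀ P.T, Q t =ᵐ[μ] q t) : ContinuousOn Q (Icc P.t₀ P.T) := by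
  obtain ⟨c, K, hb⟩ := h0.exists_uniformBounds
  set M := (measureUnivNNReal μ : ℝ) ^ ((2 : ℝ≥0∞).toReal⁻¹)
  refine LipschitzOnWith.continuousOn (K := (M * (K * |B|)).toNNReal)
    (LipschitzOnWith.of_dist_le_mul fun s hs t ht => ?_)
  have hae : ∀ᵐ ω ∂μ, ‖(Q s - Q t) ω‖ ≤ K * |B| * dist s t := by
    filter_upwards [Lp.coeFn_sub (Q s) (Q t), hQ s hs, hQ t ht] with ω hsub hs' ht'
    rw [hsub, Pi.sub_apply, hs', ht']
    exact (hq.adjoint ω).norm_sub_le (fun r hr => (hq.norm_adjoint_le hb hw ω hr).trans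
      (mul_le_mul_of_nonneg_left (le_abs_self B) K.coe_nonneg)) ht hs
  rw [dist_eq_norm]
  refine (Lp.norm_le_of_ae_bound (by positivity) hae).trans ?_
  rw [← mul_assoc]
  exact mul_le_mul_of_nonneg_right (Real.le_coe_toNNReal _) dist_nonneg

theorem IsBoundedCostate.hasW11Deriv_inner_Lp [IsFiniteMeasure μ]
    (hq : P.IsBoundedCostate μ w x q B) (h0 : P.H0) (hφ : AEStronglyMeasurable P.φ μ)
    (hr : P.IsRegular μ w x) {Q R : ℝ → Lp (StateSpace n) 2 μ}
    (hQ : ∀ t ∈ Icc P.t₀ P.T, Q t =ᵐ[μ] q t)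
    (hR : ∀ t ∈ Icc P.t₀ P.T, R t =ᵐ[μ] fun ω =>
      -ContinuousLinearMap.adjoint (P.dynJac (x t ω) (w t) ω) (q t ω))
    (W : Lp (StateSpace n) 2 μ) :
    HasW11Deriv P.t₀ P.T (fun t => inner ℝ W (Q t)) (fun t => inner ℝ W (R t)) := by
  obtain ⟨c, K, hb⟩ := h0.exists_uniformBounds
  have hab := P.time_lt.le
  have hW : Integrable (fun z : ℝ × Ω => W z.2) ((volume.restrict (Icc P.t₀ P.T)).prod μ) :=
    ((Lp.memLp W).integrable one_le_two).comp_snd _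
  have hint₀ : Integrable (fun ω => inner ℝ (W ω) (q P.t₀ ω)) μ :=
    (L2.integrable_inner W (Q P.t₀)).congr <| by
      filter_upwards [hQ P.t₀ (left_mem_Icc.2 hab)] with ω hω
      rw [hω]
  have hint : Integrable (fun z : ℝ × Ω => inner ℝ (W z.2)
      (-ContinuousLinearMap.adjoint (P.dynJac (x z.1 z.2) (w z.1) z.2) (q z.1 z.2)))
      ((volume.restrict (Icc P.t₀ P.T)).prod μ) := by
    refine (hW.norm.mul_const (K * B)).mono' (hW.aestronglyMeasurable.inner
      (h0.aestronglyMeasurable_adjoint hφ hr hq.aestronglyMeasurable_uncurry)) ?_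
    filter_upwards [ae_prod_fst_mem_Icc P.t₀ P.T] with z hz
    exact (norm_inner_le_norm _ _).trans
      (mul_le_mul_of_nonneg_left (hq.norm_adjoint_le hb hr.control z.2 hz) (norm_nonneg _))
  have h := HasW11Deriv.integral (fun ω => (hq.adjoint ω).clm_comp (innerSL ℝ (W ω))) hab
    hint₀ hint
  have h' : HasW11Deriv P.t₀ P.T (fun t => ∫ ω, inner ℝ (W ω) (q t ω) ∂μ)
      (fun t => inner ℝ W (R t)) := h.congr_ae hab <| by
    filter_upwards [ae_restrict_mem measurableSet_Icc] with t ht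
    exact (inner_eq_integral_of_ae_eq W (hR t ht)).symm
  refine ⟨h'.1, fun t ht => ?_⟩
  beta_reduce
  rw [inner_eq_integral_of_ae_eq W (hQ t ht),
    inner_eq_integral_of_ae_eq W (hQ P.t₀ (left_mem_Icc.2 hab))]
  exact h'.2 t ht

theorem IsBoundedCostate.exists_Lp_adjoint [IsFiniteMeasure μ] (hq : P.IsBoundedCostate μ w x q B)
    (h0 : P.H0) (hφ : AEStronglyMeasurable P.φ μ) (hr : P.IsRegular μ w x) :
    ∃ R : ℝ → Lp (StateSpace n) 2 μ, ∀ t ∈ Icc P.t₀ P.T, R t =ᵐ[μ] fun ω =>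
      -ContinuousLinearMap.adjoint (P.dynJac (x t ω) (w t) ω) (q t ω) := by
  obtain ⟨c, K, hb⟩ := h0.exists_uniformBounds
  refine exists_Lp_ae_eq fun t ht => MemLp.of_bound (AEMeasurable.aestronglyMeasurable ?_) (K * B)
    (ae_of_all _ fun ω => hq.norm_adjoint_le hb hr.control ω ht)
  exact (h0.aemeasurable_adjoint_dynJac
    (h0.aestronglyMeasurable_arc hφ hr.control hr.adm t ht).aemeasurable (hq.meas t ht).aemeasurable
    aemeasurable_const aemeasurable_id
    (ae_of_all _ fun ω => (hr.smooth₀ ω t ht).differentiableAt two_ne_zero)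
    (ae_of_all _ fun ω => (hr.smooth₁ ω t ht).differentiableAt two_ne_zero)).neg

theorem UniformBounds.norm_Lp_sub_adjoint_le {c K : NNReal} (hb : P.UniformBounds c K) {s : ℝ}
    (hs : s ∈ Icc P.umin P.umax) {y q : Ω → StateSpace n} {p p' Q R : Lp (StateSpace n) 2 μ}
    (hp : ∀ᵐ ω ∂μ, -p' ω = ContinuousLinearMap.adjoint (P.dynJac (y ω) s ω) (p ω))
    (hQ : Q =ᵐ[μ] q)
    (hR : R =ᵐ[μ] fun ω => -ContinuousLinearMap.adjoint (P.dynJac (y ω) s ω) (q ω)) :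
    ‖p' - R‖ ≤ K * ‖p - Q‖ := by
  refine Lp.norm_le_mul_norm_of_ae_le_mul ?_
  filter_upwards [hp, hQ, hR, Lp.coeFn_sub p' R, Lp.coeFn_sub p Q] with ω hpω hQω hRω hsub' hsub
  rw [hsub', hsub, Pi.sub_apply, Pi.sub_apply, hRω, hQω, ← neg_neg (p' ω), hpω, neg_sub_neg,
    ← map_sub, norm_sub_rev]
  exact hb.norm_adjoint_dynJac_le hs _ _ _

theorem IsCostateL2.ae_eq_of_isBoundedCostate [IsFiniteMeasure μ]
    {p : ℝ → Lp (StateSpace n) 2 μ} (hp : P.IsCostateL2 μ u x p) (h0 : P.H0)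
    (hφ : AEStronglyMeasurable P.φ μ) (hr : P.IsRegular μ w x)
    (huw : u =ᵐ[volume.restrict (Icc P.t₀ P.T)] w) (hq : P.IsBoundedCostate μ w x q B) :
    ∀ t ∈ Icc P.t₀ P.T, p t =ᵐ[μ] q t := by
  obtain ⟨c, K, hb⟩ := h0.exists_uniformBounds
  obtain ⟨p', hpp', hadj⟩ := hp.adjoint_eq
  obtain ⟨Q, hQ⟩ := exists_Lp_ae_eq (p := 2) fun t ht =>
    MemLp.of_bound (hq.meas t ht) B (ae_of_all _ fun ω => hq.bound ω t ht)
  obtain ⟨R, hR⟩ := hq.exists_Lp_adjoint h0 hφ hr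
  have hweak (W) : HasW11Deriv P.t₀ P.T (fun t => inner ℝ W (p t - Q t))
      (fun t => inner ℝ W (p' t - R t)) := by
    simp only [inner_sub_right]
    exact (hpp'.clm_comp (innerSL ℝ W)).sub (hq.hasW11Deriv_inner_Lp h0 hφ hr hQ hR W)
  have hdiff : ∀ᵐ t ∂volume.restrict (Icc P.t₀ P.T), ‖p' t - R t‖ ≤ K * ‖p t - Q t‖ := by
    filter_upwards [hadj, huw, ae_restrict_mem measurableSet_Icc] with t htadj htu ht
    rw [htu] at htadj
    exact hb.norm_Lp_sub_adjoint_le (hr.control.2 t) htadj (hQ t ht) (hR t ht)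
  have hterminal : p P.T - Q P.T = 0 := by
    refine sub_eq_zero.2 (Lp.ext ?_)
    filter_upwards [hp.terminal, hQ P.T (right_mem_Icc.2 P.time_lt.le)] with ω hpω hQω
    rw [hQω, ← neg_inj, hpω, hq.terminal ω]
  intro t ht
  have hpQ := eq_zero_of_forall_hasW11Deriv_inner_right K.coe_nonneg
    (hpp'.continuousOn.sub (hq.continuousOn_Lp h0 hr.control hQ)) hweak hdiff hterminal t ht
  rw [sub_eq_zero.1 hpQ]
  exact hQ t ht

end AffineProblem

/-! ### Smoothness along the arcs from the tube hypotheses -/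

theorem frequently_nhdsWithin_Icc_of_ae {a b : ℝ} (hab : a < b) {Q : ℝ → Prop}
    (hQ : ∀ᵐ t ∂volume.restrict (Icc a b), Q t) {t : ℝ} (ht : t ∈ Icc a b) :
    ∃ᶠ s in 𝓝[Icc a b] t, Q s := by
  have hdense := Measure.dense_of_ae ((ae_restrict_iff' measurableSet_Icc).1 hQ)
  rw [← closure_Ioo hab.ne] at ht
  have hmem := closure_minimal (hdense.open_subset_closure_inter isOpen_Ioo) isClosed_closure ht
  refine frequently_nhdsWithin_iff.2 ((mem_closure_iff_frequently.1 hmem).mono fun s hs => ?_)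
  have hsab := Ioo_subset_Icc_self hs.1
  exact ⟨hs.2 hsab, hsab⟩

section

variable {E F : Type*} [NormedAddCommGroup E] [NormedSpace ℝ E] [NormedAddCommGroup F]
  [NormedSpace ℝ F] {a b δ : ℝ} {z : ℝ → E} {f : E → F}

theorem contDiffAt_of_ae_contDiffOn_ball {k : WithTop ℕ∞} (hab : a < b)
    (hz : ContinuousOn z (Icc a b)) (hδ : 0 < δ)
    (hf : ∀ᵐ t ∂volume.restrict (Icc a b), ContDiffOn ℝ k f (Metric.ball (z t) δ)) :
    ∀ t ∈ Icc a b, ContDiffAt ℝ k f (z t) := by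
  intro t ht
  have hnear : ∀ᶠ s in 𝓝[Icc a b] t, dist (z s) (z t) < δ :=
    (hz t ht).eventually (Metric.ball_mem_nhds _ hδ)
  obtain ⟨s, hs, hst⟩ := ((frequently_nhdsWithin_Icc_of_ae hab hf ht).and_eventually hnear).exists
  exact hs.contDiffAt (Metric.isOpen_ball.mem_nhds (Metric.mem_ball'.2 hst))

theorem norm_fderiv_fderiv_le_of_ae {C : ℝ} (hab : a < b) (hz : ContinuousOn z (Icc a b))
    (hf : ∀ t ∈ Icc a b, ContDiffAt ℝ 2 f (z t))
    (hC : ∀ᵐ t ∂volume.restrict (Icc a b), ‖fderiv ℝ (fderiv ℝ f) (z t)‖ ≤ C) :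
    ∀ t ∈ Icc a b, ‖fderiv ℝ (fderiv ℝ f) (z t)‖ ≤ C := by
  intro t ht
  have hf' : ContDiffAt ℝ 1 (fderiv ℝ f) (z t) := (hf t ht).fderiv_right (by norm_num)
  have hf'' : ContinuousAt (fderiv ℝ (fderiv ℝ f)) (z t) :=
    (hf'.fderiv_right (m := 0) (by norm_num)).continuousAt
  have hnorm : ContinuousAt (fun y => ‖fderiv ℝ (fderiv ℝ f) y‖) (z t) :=
    (continuous_norm (E := E →L[ℝ] E →L[ℝ] F)).continuousAt.comp hf''
  exact le_of_tendsto_of_frequently (hnorm.tendsto.comp (hz t ht))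
    (frequently_nhdsWithin_Icc_of_ae hab hC ht)

end

namespace AffineProblem

variable {n : ℕ} {Ω : Type*} [MeasurableSpace Ω] {μ : Measure Ω} {P : AffineProblem n Ω}
  {u : ℝ → ℝ} {x : ℝ → Ω → StateSpace n}

theorem H1.isSmoothAlong [MetricSpace Ω] [HereditarilyLindelofSpace Ω] {δ : ℝ}
    (h1 : P.H1 μ x δ) (hδ : 0 < δ) (hx : P.IsAdmissible u x) : P.IsSmoothAlong μ x := by
  have hcont (ω) : ContinuousOn (fun t => x t ω) (Icc P.t₀ P.T) := (hx.2 ω).2.continuousOn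
  have hsmooth₀ (ω) := contDiffAt_of_ae_contDiffOn_ball P.time_lt (hcont ω) hδ (h1.c2_f₀ ω)
  have hsmooth₁ (ω) := contDiffAt_of_ae_contDiffOn_ball P.time_lt (hcont ω) hδ (h1.c2_f₁ ω)
  obtain ⟨_, C₀, -, -, hC₀⟩ := h1.bound_f₀
  obtain ⟨_, C₁, -, -, hC₁⟩ := h1.bound_f₁
  refine ⟨hsmooth₀, hsmooth₁, ⟨max C₀ C₁, ?_⟩, fun ω => (h1.diff_g ω).differentiableAt
    (Metric.ball_mem_nhds _ hδ)⟩
  filter_upwards [μ.support_mem_ae] with ω hω t ht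
  exact ⟨(norm_fderiv_fderiv_le_of_ae P.time_lt (hcont ω) (hsmooth₀ ω)
      ((hC₀ ω hω).mono fun s hs => hs.2.le) t ht).trans (le_max_left _ _),
    (norm_fderiv_fderiv_le_of_ae P.time_lt (hcont ω) (hsmooth₁ ω)
      ((hC₁ ω hω).mono fun s hs => hs.2.le) t ht).trans (le_max_right _ _)⟩

/-! ### Characterization of the control -/

theorem IsAdmissible.controlCharacterization [IsFiniteMeasure μ] (hx : P.IsAdmissible u x)
    (h0 : P.H0) (hs : P.IsSmoothAlong μ x) (hφ : MemLp P.φ 2 μ)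
    (hmin : ∀ w, P.IsStrictControl w → P.IsAdmissible w x → P.IsUniformLocalMin μ w x)
    {p : ℝ → Ω → StateSpace n}
    (hp : ∀ w q B, u =ᵐ[volume.restrict (Icc P.t₀ P.T)] w → P.IsRegular μ w x →
      P.IsBoundedCostate μ w x q B → ∀ t ∈ Icc P.t₀ P.T, p t =ᵐ[μ] q t) :
    P.ControlCharacterization μ u x p := by
  obtain ⟨w, hw, huw⟩ := hx.1.exists_isStrictControl
  have hr : P.IsRegular μ w x := ⟨hs, hw, hx.congr_control hw huw⟩
  obtain ⟨q, B, hq⟩ := h0.exists_isBoundedCostate hφ.1 hr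
  exact ((hmin w hw hr.adm).controlCharacterization h0 hφ hr hq).congr huw (hp w q B huw hr hq)

end AffineProblem

theorem mainTheorem2_general {n : ℕ} {Ω : Type*} [MetricSpace Ω] [HereditarilyLindelofSpace Ω]
    [MeasurableSpace Ω] {μ : Measure Ω} [IsFiniteMeasure μ] {P : AffineProblem n Ω} (h0 : P.H0)
    {u : ℝ → ℝ} {x : ℝ → Ω → StateSpace n} (hs : P.IsSmoothAlong μ x) :
    (AEStronglyMeasurable P.φ μ → (∃ R, ∀ ω ∈ μ.support, ‖P.φ ω‖ ≤ R) →
      P.IsW11LocalMin μ u x → ∀ p : ℝ → Ω → StateSpace n, P.IsCostate μ u x p →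
        P.ControlCharacterization μ u x p) ∧
    (MemLp P.φ 2 μ → P.IsW11LocalMinL2 μ u x →
      ∀ p : ℝ → Lp (StateSpace n) 2 μ, P.IsCostateL2 μ u x p →
        P.ControlCharacterization μ u x (fun t ω => p t ω)) := by
  constructor
  · rintro hφ ⟨R, hR⟩ hmin p hp
    have hφ₂ : MemLp P.φ 2 μ := .of_bound hφ R (mem_of_superset μ.support_mem_ae hR)
    refine hmin.1.controlCharacterization h0 hs hφ₂
      (fun w hw hx => hmin.isUniformLocalMin h0 hR hw hx) fun w q B huw hr hq t ht => ?_
    filter_upwards [μ.support_mem_ae] with ω hω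
    exact hp.eqOn_of_isBoundedCostate h0 hr huw hq hω ht
  · intro hφ hmin p hp
    exact hmin.1.controlCharacterization h0 hs hφ
      (fun w hw hx => hmin.isUniformLocalMin h0 hφ hw hx)
      fun w q B huw hr hq => hp.ae_eq_of_isBoundedCostate h0 hφ.1 hr huw hq

theorem mainTheorem2 {n : ℕ} {Ω : Type*} [MetricSpace Ω] [CompleteSpace Ω]
    [TopologicalSpace.SeparableSpace Ω] [MeasurableSpace Ω] [BorelSpace Ω]
    (μ : Measure Ω) [IsProbabilityMeasure μ] (P : AffineProblem n Ω) (h0 : P.H0)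
    (u : ℝ → ℝ) (x : ℝ → Ω → StateSpace n) (δ : ℝ) (hδ : 0 < δ) (h1 : P.H1 μ x δ) :
    -- known initial condition
    ((∃ x₀ : StateSpace n, ∀ ω, P.φ ω = x₀) → P.IsW11LocalMin μ u x →
      ∀ p : ℝ → Ω → StateSpace n, P.IsCostate μ u x p →
        P.ControlCharacterization μ u x p) ∧
    -- uncertain initial condition
    (MemLp P.φ 2 μ → P.IsW11LocalMinL2 μ u x →
      ∀ p : ℝ → Lp (StateSpace n) 2 μ, P.IsCostateL2 μ u x p →
        P.ControlCharacterization μ u x (fun t ω => p t ω)) := by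
  have := UniformSpace.secondCountable_of_separable Ω
  refine ⟨fun ⟨x₀, hφ⟩ hmin => ?_, fun hφ hmin => ?_⟩
  · exact (mainTheorem2_general h0 (h1.isSmoothAlong hδ hmin.1)).1
      (funext hφ ▸ aestronglyMeasurable_const) ⟨‖x₀‖, fun ω _ => (congrArg norm (hφ ω)).le⟩ hmin
  · exact (mainTheorem2_general h0 (h1.isSmoothAlong hδ hmin.1)).2 hφ hmin
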